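/- **Setting.** For $\boldsymbol k\in\mathbb Z^d$ let $\hat f_{\boldsymbol k}=\int_{\mathbb T^d}f(\boldsymbol x)e^{-2\pi i\boldsymbol k\cdot\boldsymbol x}\,d\boldsymbol x$ and put $$\|f|\mathcal H^{\alpha,\beta}(\mathbb T^d)\|^2=\sum_{\boldsymbol k\in\mathbb Z^d}|\hat f_{\boldsymbol k}|^2(1+\|\boldsymbol k\|_2^2)^{\beta}\prod_{s=1}^d(1+|k_s|^2)^{\alpha},\qquad \|f|\mathcal A(\mathbb T^d)\|=\sum_{\boldsymbol k\in\mathbb Z^d}|\hat f_{\boldsymbol k}|,$$ where $\mathcal H^{\alpha,\beta}(\mathbb T^d)$ consists of the $f\in L_2(\mathbb T^d)$ with finite norm and $\mathcal A(\mathbb T^d)$ (the Wiener algebra) of the $f\in L_1(\mathbb T^d)$ with finite norm. Functions are sampled through their continuous representatives, which exist for all $f \in \mathcal H^{\alpha,\beta}(\mathbb T^d)$ if $\min\{\alpha,\alpha+\beta\}>\frac12$. For $\boldsymbol z\in\mathbb Z^d$, $M\in\mathbb N$, and a finite $I\subset\mathbb Z^d$, the rank-1 lattice is $\Lambda(\boldsymbol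 z,M)=\{\frac jM\boldsymbol z \bmod \boldsymbol 1: j=0,\dots,M-1\}$, and the sampling operator is $$S_I^{\Lambda(\boldsymbol z,M)}f=\sum_{\boldsymbol k\in I}\Big(\frac1M\sum_{j=0}^{M-1}f\big(\tfrac jM\boldsymbol z\big)e^{-2\pi i\frac jM\boldsymbol k\cdot\boldsymbol z}\Big)e^{2\pi i\boldsymbol k\cdot\circ}.$$ $\Lambda(\boldsymbol z,M)$ is *reconstructing* for $I$ if $S_I^{\Lambda(\boldsymbol z,M)}p=p$ for all $p\in\mathrm{span}\{e^{2\pi i\boldsymbol k\cdot\circ}:\boldsymbol k\in I\}$. For $T\in[0,1)$ and $R\ge1$ let $$H_R^{d,T}=\bigcup_{\boldsymbol j\in J_R^{d,T}}Q_{j_1}\times\dots\times Q_{j_d},\qquad J_R^{d,T}=\{\boldsymbol j\in\mathbb N_0^d:\|\boldsymbol j\|_1-T\|\boldsymbol j\|_\infty\le(1-T)R+d-1\},$$ with $Q_0=\{-1,0,1\}$ and $Q_j=([-2^j,-2^{j-1}-1]\cup[2^{j-1}+1,2^j])\cap\mathbb Z$ for $j>0$. *Component-by-component (CBC) construction.*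 Let $\mathcal D(I)=\{\boldsymbol h-\boldsymbol h':\boldsymbol h,\boldsymbol h'\in I\}$, $N_I=\max_{s}\max_{\boldsymbol k,\boldsymbol l\in I}|k_s-l_s|$, and $\kappa\in\mathbb R$. A reconstructing rank-1 lattice $\Lambda(\boldsymbol z,M)$ for $I$ is *constructed by the CBC strategy* (with oversampling constant $\kappa$) if there is a modulus $p\le\kappa\max\{|\mathcal D(I)|,N_I+1\}$ such that $z_1,\dots,z_d\in\{0,\dots,p-1\}$, for each $s=1,\dots,d$ the lattice $\Lambda((z_1,\dots,z_s),p)$ is reconstructing for the projection of $I$ to the first $s$ coordinates, and $1\le M\le p$ (so $M=p$, or the lattice size has been decreased afterwards). **Theorem.** Let $d\ge2$, $\alpha>\frac12$, $\beta\le0$, $\alpha+\beta>\frac12$, and $T:=-\beta/\alpha$. There is a constant $C_1>0$ depending only on $d,\alpha,\beta$, and for every $\kappa$ there is a constant $C_2>0$ depending only on $d,\alpha,\beta,\kappa$, such that for every real $R\ge1$ and every reconstructing rank-1 lattice $\Lambda(\boldsymbol z,M)$ for $H_R^{d,T}$ constructed by the CBC strategy with oversampling constant $\kappa$, $$\big\|\mathrm{Id}-S_{H_R^{d,T}}^{\Lambda(\boldsymbol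 z,M)}\,\big|\,\mathcal H^{\alpha,\beta}(\mathbb T^d)\to\mathcal A(\mathbb T^d)\big\|\le C_1\,2^{-(\alpha+\beta-\frac12)R}\begin{cases}R^{\frac{d-1}2}&:\beta=0,\\1&:\beta<0,\end{cases}$$ and $$2^{-(\alpha+\beta-\frac12)R}\begin{cases}R^{\frac{d-1}2}&:\beta=0,\\1&:\beta<0\end{cases}\;\le\;C_2\,M^{-(\alpha+\beta-\frac12)/2}\begin{cases}(\log M)^{\frac{d-2}2(\alpha-\frac12)+\frac{d-1}2}&:\beta=0,\\1&:\beta<0.\end{cases}$$ -/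

import Mathlib

open MeasureTheory
open scoped ENNReal

noncomputable section

namespace LatticeSampling

/-- The normalised Haar measure on the torus `𝕋^d = (ℝ/ℤ)^d`; it is the measure with respect to
which `UnitAddTorus.mFourierCoeff` integrates. -/
abbrev torusMeasure (d : ℕ) : Measure (UnitAddTorus (Fin d)) :=
  Measure.pi fun _ => AddCircle.haarAddCircle

/-- The squared Fourier weight `(1 + ‖k‖₂²)^β ∏ₛ (1 + |kₛ|²)^α`. -/
def weight {d : ℕ} (α β : ℝ) (k : Fin d → ℤ) : ℝ :=
  (1 + ∑ s, (k s : ℝ) ^ 2) ^ β * ∏ s, (1 + (k s : ℝ) ^ 2) ^ α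

/-- The norm of `L₂(𝕋^d)` functions in `ℋ^{α,β}(𝕋^d)`; the space consists of those `f` for which
it is finite. -/
def hybridNorm {d : ℕ} (α β : ℝ) (f : Lp ℂ 2 (torusMeasure d)) : ℝ≥0∞ :=
  (∑' k : Fin d → ℤ,
    ENNReal.ofReal (‖UnitAddTorus.mFourierCoeff (⇑f) k‖ ^ 2 * weight α β k)) ^ (1 / 2 : ℝ)

/-- The norm `∑ₖ |ĝₖ|` of the Wiener algebra `𝒜(𝕋^d)` (infinite if `g ∉ 𝒜(𝕋^d)`). -/
def wienerNorm {d : ℕ} (g : C(UnitAddTorus (Fin d), ℂ)) : ℝ≥0∞ :=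
  ∑' k : Fin d → ℤ, ‖UnitAddTorus.mFourierCoeff (⇑g) k‖ₑ

/-- The node `(j / M) z mod 1` of the rank-1 lattice `Λ(z, M)`. -/
def latticePoint {d : ℕ} (z : Fin d → ℤ) (M j : ℕ) : UnitAddTorus (Fin d) :=
  fun s => (((j : ℝ) / (M : ℝ) * (z s : ℝ) : ℝ) : UnitAddCircle)

/-- The lattice rule for the Fourier coefficient:
`(1/M) ∑_{j<M} f((j/M) z) exp(-2πi (j/M) k·z)`. -/
def latticeCoeff {d : ℕ} (z : Fin d → ℤ) (M : ℕ) (f : C(UnitAddTorus (Fin d), ℂ))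
    (k : Fin d → ℤ) : ℂ :=
  (1 / (M : ℂ)) * ∑ j ∈ Finset.range M,
    f (latticePoint z M j) * UnitAddTorus.mFourier (-k) (latticePoint z M j)

/-- The rank-1 lattice sampling operator `S_I^{Λ(z,M)}`. -/
def samplingOperator {d : ℕ} (I : Finset (Fin d → ℤ)) (z : Fin d → ℤ) (M : ℕ)
    (f : C(UnitAddTorus (Fin d), ℂ)) : C(UnitAddTorus (Fin d), ℂ) :=
  ∑ k ∈ I, latticeCoeff z M f k • UnitAddTorus.mFourier k

/-- `Λ(z, M)` is a reconstructing rank-1 lattice for `I`: the sampling operator reproduces every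
trigonometric polynomial with frequencies in `I`. -/
def IsReconstructing {d : ℕ} (I : Finset (Fin d → ℤ)) (z : Fin d → ℤ) (M : ℕ) : Prop :=
  ∀ p ∈ Submodule.span ℂ
      ((fun k : Fin d → ℤ => UnitAddTorus.mFourier k) '' (I : Set (Fin d → ℤ))),
    samplingOperator I z M p = p

/-- The operator norm of `Id - S_I^{Λ(z,M)}` from `ℋ^{α,β}(𝕋^d)` to `𝒜(𝕋^d)`.
The sampling operator acts on the continuous representative `g` of `f`. It is unique, because the
measure charges every nonempty open set, so that the infimum below is over at most one `g`; a class
`f` without a continuous representative, which could not be sampled, would contribute `∞`. -/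
def samplingErrorNorm {d : ℕ} (α β : ℝ) (I : Finset (Fin d → ℤ)) (z : Fin d → ℤ) (M : ℕ) :
    ℝ≥0∞ :=
  ⨆ (f : Lp ℂ 2 (torusMeasure d)) (_ : hybridNorm α β f ≤ 1),
    ⨅ (g : C(UnitAddTorus (Fin d), ℂ)) (_ : ⇑g =ᵐ[torusMeasure d] ⇑f),
      wienerNorm (g - samplingOperator I z M g)

/-- The dyadic blocks `Q_0 = {-1, 0, 1}` and, for `j > 0`,
`Q_j = ([-2^j, -2^(j-1) - 1] ∪ [2^(j-1) + 1, 2^j]) ∩ ℤ`. -/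
def dyadicBlock (j : ℕ) : Set ℤ :=
  if j = 0 then {-1, 0, 1}
  else Set.Icc (-2 ^ j) (-2 ^ (j - 1) - 1) ∪ Set.Icc (2 ^ (j - 1) + 1) (2 ^ j)

/-- `J_R^{d,T} = {j ∈ ℕ₀^d : ‖j‖₁ - T ‖j‖_∞ ≤ (1 - T) R + d - 1}`. -/
def levelSet (d : ℕ) (T R : ℝ) : Set (Fin d → ℕ) :=
  {j | ((∑ s, j s : ℕ) : ℝ) - T * ((Finset.univ.sup j : ℕ) : ℝ) ≤ (1 - T) * R + (d : ℝ) - 1}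

/-- The generalised dyadic hyperbolic cross `H_R^{d,T} = ⋃_{j ∈ J_R^{d,T}} Q_{j₁} × ⋯ × Q_{j_d}`. -/
def hyperbolicCross (d : ℕ) (T R : ℝ) : Set (Fin d → ℤ) :=
  ⋃ j ∈ levelSet d T R, {k | ∀ s, k s ∈ dyadicBlock (j s)}

/-- The difference set `𝒟(I) = {h¹ - h² : h¹, h² ∈ I}`. -/
def differenceSet {d : ℕ} (I : Finset (Fin d → ℤ)) : Finset (Fin d → ℤ) :=
  Finset.image₂ (fun h h' => h - h') I I

/-- The largest side length `N_I = max_s max_{k,l ∈ I} |k_s - l_s|` of the bounding box of `I`. -/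
def boxWidth {d : ℕ} (I : Finset (Fin d → ℤ)) : ℕ :=
  (differenceSet I).sup fun k => Finset.univ.sup fun s => (k s).natAbs

/-- The first `s` components of a vector. -/
def firstComponents {d s : ℕ} (hs : s ≤ d) (k : Fin d → ℤ) : Fin s → ℤ :=
  fun t => k (Fin.castLE hs t)

/-- `Λ(z, M)` is an output of the component-by-component search for a reconstructing rank-1
lattice for `I`, started with a modulus `p ≤ κ max(|𝒟(I)|, N_I + 1)`:
the components `z_1, z_2, … ∈ {0, …, p-1}` are chosen one after the other such that
`Λ((z_1,…,z_s), p)` is reconstructing for the projection of `I` to the first `s` coordinates;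
afterwards the lattice size may be decreased from `p` to some `M ≤ p` (`M = p` is allowed), as
long as `Λ(z, M)` remains reconstructing for `I`.

If `p` is a prime with `p > N_I` and `2 p > |𝒟(I)|`, a suitable component exists in every step:
each of the at most `(|𝒟(I)| - 1) / 2` pairs `±h ∈ 𝒟(I)`, `h ≠ 0`, excludes at most one value of
`z_s`. By Bertrand's postulate there is such a prime below `2 max(|𝒟(I)|, N_I + 1)`. -/
def IsCBCReconstructing {d : ℕ} (κ : ℝ) (I : Finset (Fin d → ℤ)) (z : Fin d → ℤ) (M : ℕ) :
    Prop :=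
  ∃ p : ℕ,
    (p : ℝ) ≤ κ * (max (differenceSet I).card (boxWidth I + 1) : ℕ) ∧
    (∀ s, 0 ≤ z s ∧ z s < (p : ℤ)) ∧
    (∀ (s : ℕ) (hs : s ≤ d), 1 ≤ s →
      IsReconstructing (I.image (firstComponents hs)) (firstComponents hs z) p) ∧
    0 < M ∧ M ≤ p ∧ IsReconstructing I z M

theorem dyadicBlock_finite (j : ℕ) : (dyadicBlock j).Finite := by
  unfold dyadicBlock
  split_ifs
  · exact Set.toFinite _
  · exact (Set.finite_Icc _ _).union (Set.finite_Icc _ _)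

/-- For `0 ≤ T < 1` the hyperbolic cross is a finite set. -/
theorem hyperbolicCross_finite (d : ℕ) {T : ℝ} (hT0 : 0 ≤ T) (hT1 : T < 1) (R : ℝ) :
    (hyperbolicCross d T R).Finite := by
  have hJ : (levelSet d T R).Finite := by
    refine (Set.Finite.pi' (t := fun _ : Fin d =>
      Set.Iic (Nat.ceil (((1 - T) * R + d - 1) / (1 - T)))) fun _ => Set.finite_Iic _).subset ?_
    intro j hj s
    have hj' : ((∑ s, j s : ℕ) : ℝ) - T * ((Finset.univ.sup j : ℕ) : ℝ)
        ≤ (1 - T) * R + (d : ℝ) - 1 := hj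
    have h1 : Finset.univ.sup j ≤ ∑ s, j s :=
      Finset.sup_le fun i _ => Finset.single_le_sum (f := j) (fun _ _ => Nat.zero_le _)
        (Finset.mem_univ i)
    have h2 : j s ≤ ∑ s, j s := Finset.single_le_sum (f := j) (fun _ _ => Nat.zero_le _)
        (Finset.mem_univ s)
    have h1' : ((Finset.univ.sup j : ℕ) : ℝ) ≤ ((∑ s, j s : ℕ) : ℝ) := by exact_mod_cast h1
    have h2' : (j s : ℝ) ≤ ((∑ s, j s : ℕ) : ℝ) := by exact_mod_cast h2
    have h3 : (j s : ℝ) ≤ ((1 - T) * R + d - 1) / (1 - T) := by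
      rw [le_div_iff₀ (by linarith)]
      nlinarith [mul_le_mul_of_nonneg_left h1' hT0,
        mul_le_mul_of_nonneg_right h2' (by linarith : (0 : ℝ) ≤ 1 - T)]
    exact_mod_cast h3.trans (Nat.le_ceil _)
  exact hJ.biUnion fun j _ => Set.Finite.pi' fun s => dyadicBlock_finite (j s)

end LatticeSampling

end

/-! A reconstructing lattice aliases each frequency to at most one element of `I`, and a frequency
of `I` only to itself. Hence the truncation error and the aliasing error are each at most the ℓ¹
mass of the Fourier coefficients outside `I` (`IsReconstructing.wienerNorm_sub_le`). By a weighted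
Cauchy-Schwarz inequality this mass is at most the norm times the square root of the sum of the
inverse weights outside `I`.

At dyadic level `j` the inverse weight is `O(2^(-2α‖j‖₁ - 2β‖j‖_∞))`, and there are `O(2^‖j‖₁)`
frequencies. Put `m = ‖j‖_∞` and `b = ‖j‖₁ - m`; at most `d (b+1)^(d-2)` multi-indices share a pair
`(m, b)`. For `T > 0`, summing over `m` leaves the factor `2^(-bT/(1-T))`, so the sum over `b`
converges and no logarithm appears. For `T = 0` this decay is absent, and counting the multi-indices
by their sum gives the power `R^(d-1)` (`exists_tsum_inv_weight_le`).

For the rate in `M`, the lattice size is at most `κ` times the larger of `|𝒟(I)|` and the box width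
plus one. If `T > 0`, then `|𝒟(I)| ≤ |I|² = O(4^R)`. If `T = 0`, squaring `|I|` costs too many
logarithms; splitting the coordinates according to which of `h`, `h'` has the larger level gives
`O(4^R R^(d-2))` instead (`card_differenceSet_le`). Finally `M ≥ |I| ≥ 2^R` turns powers of `R` into
powers of `log M`. -/

namespace LatticeSampling

open UnitAddTorus

/-! ### Counting multi-indices with a given sum -/

/-- Counting along the fibres of `g`. -/
theorem tsum_comp_le_of_card_fiber {A B : Type*} (g : A → B) (f : B → ℝ≥0∞) (c : B → ℕ)
    (hc : ∀ b, ∃ s : Finset A, (∀ a, g a = b → a ∈ s) ∧ s.card ≤ c b) :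
    ∑' a, f (g a) ≤ ∑' b, (c b : ℝ≥0∞) * f b := by
  classical
  have h1 : ∀ a, f (g a) = ∑' b, if g a = b then f b else 0 := fun a => by
    rw [tsum_eq_single (g a)]
    · simp
    · intro b hb
      rw [if_neg (Ne.symm hb)]
  rw [tsum_congr h1, ENNReal.tsum_comm]
  refine ENNReal.tsum_le_tsum fun b => ?_
  obtain ⟨s, hs, hcard⟩ := hc b
  rw [tsum_eq_sum (s := s) fun a ha => if_neg fun h => ha (hs a h)]
  calc ∑ a ∈ s, (if g a = b then f b else 0) ≤ ∑ _a ∈ s, f b :=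
        Finset.sum_le_sum fun a _ => by split_ifs <;> simp
    _ = (s.card : ℝ≥0∞) * f b := by rw [Finset.sum_const, nsmul_eq_mul]
    _ ≤ (c b : ℝ≥0∞) * f b := by gcongr

/-- A multi-index of sum `b` is determined by all its entries but one, each of which is at most `b`.
-/
theorem tsum_comp_sum_le {ι : Type*} [Fintype ι] [Nonempty ι] (f : ℕ → ℝ≥0∞) :
    ∑' r : ι → ℕ, f (∑ i, r i) ≤
      ∑' b : ℕ, (((b + 1) ^ (Fintype.card ι - 1) : ℕ) : ℝ≥0∞) * f b := by
  classical
  refine tsum_comp_le_of_card_fiber (fun r : ι → ℕ => ∑ i, r i) f _ fun b => ?_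
  refine ⟨Finset.piAntidiag Finset.univ b, fun r hr => by simpa using hr, ?_⟩
  obtain ⟨i₀⟩ := ‹Nonempty ι›
  have hcard : (Fintype.piFinset fun _ : {i // i ≠ i₀} => Finset.range (b + 1)).card
      = (b + 1) ^ (Fintype.card ι - 1) := by
    simp [Fintype.card_piFinset]
  rw [← hcard]
  refine Finset.card_le_card_of_injOn (fun r i => r i.1) ?_ ?_
  · intro r hr
    have hr' : ∑ i, r i = b := by simpa using hr
    simp only [Fintype.coe_piFinset, Set.mem_pi, Finset.coe_range]
    intro i _
    have := Finset.single_le_sum (f := r) (fun _ _ => Nat.zero_le _) (Finset.mem_univ i.1)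
    simp only [Set.mem_Iio]
    omega
  · intro r hr r' hr' h
    have h1 : ∑ i, r i = b := by simpa using hr
    have h2 : ∑ i, r' i = b := by simpa using hr'
    have h3 : ∀ i, i ≠ i₀ → r i = r' i := fun i hi => congrFun h ⟨i, hi⟩
    have h4 : ∑ i ∈ Finset.univ.erase i₀, r i = ∑ i ∈ Finset.univ.erase i₀, r' i :=
      Finset.sum_congr rfl fun i hi => h3 i (Finset.ne_of_mem_erase hi)
    have h5 := Finset.add_sum_erase Finset.univ r (Finset.mem_univ i₀)
    have h6 := Finset.add_sum_erase Finset.univ r' (Finset.mem_univ i₀)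
    ext i
    by_cases hi : i = i₀
    · subst hi
      omega
    · exact h3 i hi

/-! ### Dyadic levels, and sums over maximum and sum of a multi-index -/

/-- The index of the dyadic block containing an integer. -/
def dyadicLevel (k : ℤ) : ℕ := Nat.clog 2 k.natAbs

theorem natAbs_le_two_pow_dyadicLevel (k : ℤ) : k.natAbs ≤ 2 ^ dyadicLevel k :=
  Nat.le_pow_clog one_lt_two _

theorem dyadicLevel_le {k : ℤ} {j : ℕ} (h : k.natAbs ≤ 2 ^ j) : dyadicLevel k ≤ j :=
  Nat.clog_le_of_le_pow h

theorem two_pow_lt_natAbs {k : ℤ} (h : dyadicLevel k ≠ 0) : 2 ^ (dyadicLevel k - 1) < k.natAbs :=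
  Nat.pow_lt_of_lt_clog (by unfold dyadicLevel at *; omega)

theorem mem_dyadicBlock_dyadicLevel (k : ℤ) : k ∈ dyadicBlock (dyadicLevel k) := by
  have h1 := natAbs_le_two_pow_dyadicLevel k
  unfold dyadicBlock
  split_ifs with h
  · rw [h] at h1
    simp only [Set.mem_insert_iff, Set.mem_singleton_iff]
    omega
  · have h2 := two_pow_lt_natAbs h
    zify at h1 h2
    simp only [Set.mem_union, Set.mem_Icc]
    rcases abs_cases k with ⟨h3, _⟩ | ⟨h3, _⟩
    · right; constructor <;> linarith
    · left; constructor <;> linarith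

theorem natAbs_le_of_mem_dyadicBlock {k : ℤ} {j : ℕ} (h : k ∈ dyadicBlock j) :
    k.natAbs ≤ 2 ^ j := by
  unfold dyadicBlock at h
  split_ifs at h with h0
  · subst h0
    simp only [Set.mem_insert_iff, Set.mem_singleton_iff] at h
    omega
  · have h1 : (0 : ℤ) < 2 ^ (j - 1) := by positivity
    have h2 : |k| ≤ 2 ^ j := by
      rw [abs_le]
      simp only [Set.mem_union, Set.mem_Icc] at h
      have h3 : (0 : ℤ) < 2 ^ j := by positivity
      rcases h with h | h <;> constructor <;> linarith
    zify
    exact h2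

/-- An integer of level `j` lies in `[-2^j, 2^j]`, which has `2 * 2^j + 1 ≤ 3 * 2^j` elements. -/
theorem tsum_comp_dyadicLevel_le {ι : Type*} [Fintype ι] (F : (ι → ℕ) → ℝ≥0∞) :
    ∑' k : ι → ℤ, F (fun i => dyadicLevel (k i)) ≤
      3 ^ Fintype.card ι * ∑' j : ι → ℕ, 2 ^ (∑ i, j i) * F j := by
  classical
  have := tsum_comp_le_of_card_fiber (fun (k : ι → ℤ) i => dyadicLevel (k i)) F
    (fun j => 3 ^ Fintype.card ι * 2 ^ (∑ i, j i)) fun j => by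
      refine ⟨Fintype.piFinset fun i => Finset.Icc (-2 ^ j i) (2 ^ j i), ?_, ?_⟩
      · rintro k rfl
        simp only [Fintype.mem_piFinset, Finset.mem_Icc]
        intro i
        have h1 := natAbs_le_two_pow_dyadicLevel (k i)
        zify at h1
        exact abs_le.1 h1
      · rw [Fintype.card_piFinset, ← Finset.prod_pow_eq_pow_sum, ← Finset.card_univ,
          ← Finset.prod_const, ← Finset.prod_mul_distrib]
        refine Finset.prod_le_prod' fun i _ => ?_
        rw [Int.card_Icc]
        have h1 : (1 : ℤ) ≤ 2 ^ j i := one_le_pow₀ (by norm_num)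
        have h2 : ((2 : ℤ) ^ j i + 1 - -2 ^ j i) ≤ ((3 * 2 ^ j i : ℕ) : ℤ) := by
          push_cast
          linarith
        exact Int.toNat_le.2 h2
  refine this.trans_eq ?_
  rw [← ENNReal.tsum_mul_left]
  refine tsum_congr fun j => ?_
  push_cast
  ring

/-- Sums of functions of the maximum and the sum of a multi-index. -/
theorem tsum_comp_sup_sum_le {ι : Type*} [Fintype ι] [Nontrivial ι] (F : ℕ → ℕ → ℝ≥0∞) :
    ∑' j : ι → ℕ, F (Finset.univ.sup j) (∑ i, j i) ≤
      Fintype.card ι * ∑' b : ℕ, (((b + 1) ^ (Fintype.card ι - 2) : ℕ) : ℝ≥0∞) *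
        ∑' m : ℕ, F m (m + b) := by
  classical
  -- Union bound over the coordinate `i₀` that attains the maximum. Afterwards `j i₀` is treated as
  -- free, and the other entries, of sum `b`, are counted by `tsum_comp_sum_le` in one variable
  -- fewer.
  have h1 : ∀ j : ι → ℕ, F (Finset.univ.sup j) (∑ i, j i) ≤ ∑ i₀, F (j i₀) (∑ i, j i) := by
    intro j
    obtain ⟨i₀, -, hi₀⟩ := Finset.exists_mem_eq_sup Finset.univ Finset.univ_nonempty j
    rw [hi₀]
    exact Finset.single_le_sum (f := fun i₀ => F (j i₀) (∑ i, j i)) (fun _ _ => zero_le)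
      (Finset.mem_univ i₀)
  refine (ENNReal.tsum_le_tsum h1).trans ?_
  rw [Summable.tsum_finsetSum fun _ _ => ENNReal.summable]
  rw [← Finset.card_univ, ← nsmul_eq_mul]
  refine Finset.sum_le_card_nsmul _ _ _ fun i₀ _ => ?_
  rw [← (Equiv.funSplitAt i₀ ℕ).symm.tsum_eq]
  have h2 : ∀ p : ℕ × ({i // i ≠ i₀} → ℕ),
      F ((Equiv.funSplitAt i₀ ℕ).symm p i₀) (∑ i, (Equiv.funSplitAt i₀ ℕ).symm p i)
        = F p.1 (p.1 + ∑ i, p.2 i) := by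
    rintro ⟨m, r⟩
    congr 1
    · simp [Equiv.funSplitAt, Equiv.piSplitAt]
    · rw [← Finset.add_sum_erase _ _ (Finset.mem_univ i₀)]
      congr 1
      · simp [Equiv.funSplitAt, Equiv.piSplitAt]
      · rw [Finset.sum_subtype (p := fun i => i ≠ i₀) (Finset.univ.erase i₀) (by simp)]
        refine Finset.sum_congr rfl fun i _ => ?_
        simp [Equiv.funSplitAt, Equiv.piSplitAt, i.2]
  rw [tsum_congr h2, ENNReal.tsum_prod', ENNReal.tsum_comm]
  obtain ⟨i₁, hi₁⟩ := exists_ne i₀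
  have : Nonempty {i // i ≠ i₀} := ⟨⟨i₁, hi₁⟩⟩
  have h3 := tsum_comp_sum_le (ι := {i // i ≠ i₀}) fun b => ∑' m : ℕ, F m (m + b)
  refine h3.trans_eq ?_
  have h4 : Fintype.card {i // i ≠ i₀} - 1 = Fintype.card ι - 2 := by
    simp
    omega
  rw [h4, Finset.card_univ]

/-! ### Geometric sums inside and outside the level set -/

theorem two_rpow_add (x y : ℝ) : (2 : ℝ≥0∞) ^ (x + y) = 2 ^ x * 2 ^ y :=
  ENNReal.rpow_add x y (by norm_num) (by norm_num)

theorem two_rpow_le {x y : ℝ} (h : x ≤ y) : (2 : ℝ≥0∞) ^ x ≤ 2 ^ y :=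
  ENNReal.rpow_le_rpow_of_exponent_le (by norm_num) h

theorem ofReal_two_rpow (x : ℝ) : ENNReal.ofReal ((2 : ℝ) ^ x) = (2 : ℝ≥0∞) ^ x := by
  rw [← ENNReal.ofReal_rpow_of_pos two_pos]
  norm_num

theorem two_rpow_ne_top (x : ℝ) : (2 : ℝ≥0∞) ^ x ≠ ⊤ := by
  rw [← ofReal_two_rpow]
  exact ENNReal.ofReal_ne_top

/-- The sum `∑ (b + 1)^k 2^(-δ b)`. -/
noncomputable def geomMoment (k : ℕ) (δ : ℝ) : ℝ≥0∞ :=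
  ∑' b : ℕ, (((b + 1) ^ k : ℕ) : ℝ≥0∞) * 2 ^ (-δ * (b : ℝ))

theorem geomMoment_ne_top (k : ℕ) {δ : ℝ} (hδ : 0 < δ) : geomMoment k δ ≠ ⊤ := by
  set q : ℝ := 2 ^ (-δ) with hq
  have hq0 : 0 < q := by positivity
  have hq1 : q < 1 := Real.rpow_lt_one_of_one_lt_of_neg one_lt_two (by linarith)
  have hs : Summable fun b : ℕ => ((b + 1 : ℕ) : ℝ) ^ k * q ^ (b + 1) :=
    (summable_nat_add_iff 1 (f := fun b : ℕ => ((b : ℕ) : ℝ) ^ k * q ^ b)).2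
      (summable_pow_mul_geometric_of_norm_lt_one k
        (by rwa [Real.norm_eq_abs, abs_of_pos hq0]))
  have hs' : Summable fun b : ℕ => ((b + 1 : ℕ) : ℝ) ^ k * q ^ b := by
    refine (hs.mul_right q⁻¹).congr fun b => ?_
    rw [pow_succ]
    field_simp
  have h1 : geomMoment k δ = ∑' b : ℕ, ENNReal.ofReal (((b + 1 : ℕ) : ℝ) ^ k * q ^ b) := by
    refine tsum_congr fun b => ?_
    rw [ENNReal.ofReal_mul (by positivity), ← Nat.cast_pow, ENNReal.ofReal_natCast, hq,
      ← Real.rpow_mul_natCast zero_le_two, ofReal_two_rpow]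
  rw [h1]
  exact hs'.tsum_ofReal_ne_top

theorem tsum_ite_ge_le (n : ℕ) (f : ℕ → ℝ≥0∞) :
    ∑' m : ℕ, (if n ≤ m then f m else 0) = ∑' t : ℕ, f (n + t) := by
  rw [← Summable.sum_add_tsum_nat_add' (k := n) ENNReal.summable, Finset.sum_eq_zero, zero_add]
  · exact tsum_congr fun t => by rw [if_pos (by omega), add_comm]
  · intro i hi
    rw [if_neg (by simpa using hi)]

/-- The threshold `x` may be negative, as `R - b / (1 - T)` is for large `b`. Its natural ceiling is
then 0, and `x ≤ ⌈x⌉₊` still holds. -/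
theorem tsum_geom_tail_le {A : ℝ} (hA : 0 < A) (x : ℝ) :
    ∑' m : ℕ, (if x ≤ m then (2 : ℝ≥0∞) ^ (-A * (m : ℝ)) else 0) ≤
      geomMoment 0 A * 2 ^ (-A * x) := by
  have h1 : ∀ m : ℕ, (if x ≤ m then (2 : ℝ≥0∞) ^ (-A * (m : ℝ)) else 0)
      = if ⌈x⌉₊ ≤ m then (2 : ℝ≥0∞) ^ (-A * (m : ℝ)) else 0 := fun m => by
    simp only [Nat.ceil_le]
  rw [tsum_congr h1, tsum_ite_ge_le, geomMoment, ← ENNReal.tsum_mul_right]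
  refine ENNReal.tsum_le_tsum fun t => ?_
  rw [pow_zero, Nat.cast_one, one_mul, ← two_rpow_add]
  refine two_rpow_le ?_
  push_cast
  nlinarith [Nat.le_ceil x]

theorem tsum_geom_head_le (y : ℝ) :
    ∑' m : ℕ, (if (m : ℝ) ≤ y then (2 : ℝ≥0∞) ^ (m : ℝ) else 0) ≤ 2 * 2 ^ y := by
  rcases lt_or_ge y 0 with hy | hy
  · rw [ENNReal.tsum_eq_zero.2]
    · exact zero_le
    · intro m
      rw [if_neg]
      have : (0 : ℝ) ≤ m := Nat.cast_nonneg m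
      linarith
  · rw [tsum_eq_sum (s := Finset.range (⌊y⌋₊ + 1))]
    · calc ∑ m ∈ Finset.range (⌊y⌋₊ + 1), (if (m : ℝ) ≤ y then (2 : ℝ≥0∞) ^ (m : ℝ) else 0)
          ≤ ∑ m ∈ Finset.range (⌊y⌋₊ + 1), ((2 ^ m : ℕ) : ℝ≥0∞) := by
            refine Finset.sum_le_sum fun m _ => ?_
            split_ifs
            · rw [ENNReal.rpow_natCast]
              push_cast
              exact le_rfl
            · exact zero_le
        _ ≤ ((2 ^ (⌊y⌋₊ + 1) : ℕ) : ℝ≥0∞) := by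
            rw [← Nat.cast_sum]
            exact_mod_cast (Nat.geomSum_lt le_rfl fun k hk => by simpa using hk).le
        _ ≤ 2 * 2 ^ y := by
            rw [pow_succ, mul_comm, Nat.cast_mul]
            push_cast
            gcongr
            rw [← ENNReal.rpow_natCast]
            exact two_rpow_le (Nat.floor_le hy)
    · intro m hm
      rw [if_neg]
      intro h
      exact hm (Finset.mem_range.2 (Nat.lt_succ_of_le (Nat.le_floor h)))

/-- The hyperbolic cross for `T > 0` has at most a constant times `2^R` elements, dyadically. -/
theorem tsum_levelSet_le {ι : Type*} [Fintype ι] [Nontrivial ι] {T : ℝ}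
    (hT1 : T < 1) (c R : ℝ) :
    ∑' j : ι → ℕ, (if ((∑ i, j i : ℕ) : ℝ) - T * ((Finset.univ.sup j : ℕ) : ℝ) ≤ (1 - T) * R + c
        then (2 : ℝ≥0∞) ^ ((∑ i, j i : ℕ) : ℝ) else 0) ≤
      Fintype.card ι * (2 * 2 ^ (c / (1 - T)) *
        geomMoment (Fintype.card ι - 2) (T / (1 - T))) * 2 ^ R := by
  have hT : 0 < 1 - T := by linarith
  refine (tsum_comp_sup_sum_le fun m a => if (a : ℝ) - T * m ≤ (1 - T) * R + c
    then (2 : ℝ≥0∞) ^ (a : ℝ) else 0).trans ?_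
  rw [mul_assoc]
  refine mul_le_mul_right ?_ _
  rw [geomMoment, ← ENNReal.tsum_mul_left, ← ENNReal.tsum_mul_right]
  refine ENNReal.tsum_le_tsum fun b => ?_
  have h1 : ∀ m : ℕ, (if ((m + b : ℕ) : ℝ) - T * m ≤ (1 - T) * R + c
      then (2 : ℝ≥0∞) ^ ((m + b : ℕ) : ℝ) else 0) =
      (if (m : ℝ) ≤ R + (c - b) / (1 - T) then (2 : ℝ≥0∞) ^ (m : ℝ) else 0) * 2 ^ (b : ℝ) := by
    intro m
    have h2 : ((m + b : ℕ) : ℝ) - T * m ≤ (1 - T) * R + c ↔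
        (m : ℝ) ≤ R + (c - b) / (1 - T) := by
      rw [← sub_le_iff_le_add' (b := R), le_div_iff₀ hT]
      push_cast
      constructor <;> intro h <;> linarith
    simp only [h2]
    split_ifs
    · rw [← two_rpow_add]
      push_cast
      rfl
    · rw [zero_mul]
  rw [tsum_congr h1, ENNReal.tsum_mul_right]
  calc (((b + 1) ^ (Fintype.card ι - 2) : ℕ) : ℝ≥0∞) *
        ((∑' m : ℕ, if (m : ℝ) ≤ R + (c - b) / (1 - T) then (2 : ℝ≥0∞) ^ (m : ℝ) else 0) *
          2 ^ (b : ℝ))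
      ≤ (((b + 1) ^ (Fintype.card ι - 2) : ℕ) : ℝ≥0∞) *
        (2 * 2 ^ (R + (c - b) / (1 - T)) * 2 ^ (b : ℝ)) := by
          gcongr
          exact tsum_geom_head_le _
    -- The exponent of `b` is `1 - 1 / (1 - T) = -T / (1 - T)`.
    _ = (((b + 1) ^ (Fintype.card ι - 2) : ℕ) : ℝ≥0∞) *
        (2 * (2 ^ (c / (1 - T)) * 2 ^ (-(T / (1 - T)) * b) * 2 ^ R)) := by
          rw [← two_rpow_add, ← two_rpow_add, mul_assoc 2, ← two_rpow_add]
          congr 3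
          field_simp
          ring
    _ = _ := by ring

/-- In terms of the maximum `m` and the remainder `b`, the summand is `2^(-A m - B b)` and the
condition is `m ≥ R - b / (1 - T)`. The tail in `m` contributes `2^(-A R + A b / (1 - T))`, and
`hAB` makes the total exponent of `b` equal to `-T / (1 - T)`. For `T = 0` the second moment is
infinite, so that case needs `tsum_compl_simplex_le`. -/
theorem tsum_compl_levelSet_le {ι : Type*} [Fintype ι] [Nontrivial ι] {T A B : ℝ}
    (hT1 : T < 1) (hA : 0 < A) (hAB : B * (1 - T) = A + T) (R : ℝ) :
    ∑' j : ι → ℕ, (if (1 - T) * R ≤ ((∑ i, j i : ℕ) : ℝ) - T * ((Finset.univ.sup j : ℕ) : ℝ)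
        then (2 : ℝ≥0∞) ^ (-B * ((∑ i, j i : ℕ) : ℝ) + (B - A) * ((Finset.univ.sup j : ℕ) : ℝ))
        else 0) ≤
      Fintype.card ι * (geomMoment 0 A * geomMoment (Fintype.card ι - 2) (T / (1 - T))) *
        2 ^ (-A * R) := by
  have hT : 0 < 1 - T := by linarith
  refine (tsum_comp_sup_sum_le fun m a => if (1 - T) * R ≤ (a : ℝ) - T * m
    then (2 : ℝ≥0∞) ^ (-B * (a : ℝ) + (B - A) * m) else 0).trans ?_
  rw [mul_assoc]
  refine mul_le_mul_right ?_ _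
  rw [geomMoment.eq_1 (Fintype.card ι - 2), ← ENNReal.tsum_mul_left, ← ENNReal.tsum_mul_right]
  refine ENNReal.tsum_le_tsum fun b => ?_
  have h1 : ∀ m : ℕ, (if (1 - T) * R ≤ ((m + b : ℕ) : ℝ) - T * m
      then (2 : ℝ≥0∞) ^ (-B * ((m + b : ℕ) : ℝ) + (B - A) * m) else 0) =
      (if R - b / (1 - T) ≤ (m : ℝ) then (2 : ℝ≥0∞) ^ (-A * (m : ℝ)) else 0) *
        2 ^ (-B * (b : ℝ)) := by
    intro m
    have h2 : (1 - T) * R ≤ ((m + b : ℕ) : ℝ) - T * m ↔ R - b / (1 - T) ≤ (m : ℝ) := by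
      rw [sub_le_comm, le_div_iff₀ hT]
      push_cast
      constructor <;> intro h <;> linarith
    simp only [h2]
    split_ifs
    · rw [← two_rpow_add]
      push_cast
      congr 1
      ring
    · rw [zero_mul]
  rw [tsum_congr h1, ENNReal.tsum_mul_right]
  calc (((b + 1) ^ (Fintype.card ι - 2) : ℕ) : ℝ≥0∞) *
        ((∑' m : ℕ, if R - b / (1 - T) ≤ (m : ℝ) then (2 : ℝ≥0∞) ^ (-A * (m : ℝ)) else 0) *
          2 ^ (-B * (b : ℝ)))
      ≤ (((b + 1) ^ (Fintype.card ι - 2) : ℕ) : ℝ≥0∞) *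
        (geomMoment 0 A * 2 ^ (-A * (R - b / (1 - T))) * 2 ^ (-B * (b : ℝ))) := by
          gcongr
          exact tsum_geom_tail_le hA _
    _ = (((b + 1) ^ (Fintype.card ι - 2) : ℕ) : ℝ≥0∞) *
        (geomMoment 0 A * (2 ^ (-(T / (1 - T)) * b) * 2 ^ (-A * R))) := by
          rw [mul_assoc (geomMoment 0 A), ← two_rpow_add, ← two_rpow_add]
          congr 3
          have hB : B = (A + T) / (1 - T) := by rw [← hAB]; field_simp
          rw [hB]
          field_simp
          ring
    _ = _ := by ring

theorem tsum_compl_simplex_le {ι : Type*} [Fintype ι] [Nonempty ι] {A : ℝ} (hA : 0 < A) {R : ℝ}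
    (hR : 1 ≤ R) :
    ∑' j : ι → ℕ, (if R ≤ ((∑ i, j i : ℕ) : ℝ)
        then (2 : ℝ≥0∞) ^ (-A * ((∑ i, j i : ℕ) : ℝ)) else 0) ≤
      3 ^ (Fintype.card ι - 1) * geomMoment (Fintype.card ι - 1) A *
        (ENNReal.ofReal R ^ (Fintype.card ι - 1) * 2 ^ (-A * R)) := by
  refine (tsum_comp_sum_le fun b => if R ≤ (b : ℝ) then (2 : ℝ≥0∞) ^ (-A * (b : ℝ)) else 0).trans ?_
  simp only [mul_ite, mul_zero, ← Nat.ceil_le]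
  rw [tsum_ite_ge_le, geomMoment, ← ENNReal.tsum_mul_left, ← ENNReal.tsum_mul_right]
  refine ENNReal.tsum_le_tsum fun t => ?_
  have h1 : (((⌈R⌉₊ + t + 1) ^ (Fintype.card ι - 1) : ℕ) : ℝ≥0∞) ≤
      3 ^ (Fintype.card ι - 1) * (((t + 1) ^ (Fintype.card ι - 1) : ℕ) : ℝ≥0∞) *
        ENNReal.ofReal R ^ (Fintype.card ι - 1) := by
    push_cast
    rw [← mul_pow, ← mul_pow]
    refine pow_le_pow_left' ?_ _
    -- This separates the power of `R` from the convergent moment in `t`; `R ≥ 1` absorbs the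
    -- additive constants.
    have h2 : ((⌈R⌉₊ + t + 1 : ℕ) : ℝ) ≤ 3 * (t + 1 : ℕ) * R := by
      have := Nat.ceil_lt_add_one (by linarith : 0 ≤ R)
      have ht : (0 : ℝ) ≤ t := Nat.cast_nonneg t
      push_cast
      nlinarith
    have h3 := ENNReal.ofReal_le_ofReal h2
    rw [ENNReal.ofReal_mul (by positivity), ENNReal.ofReal_mul (by positivity),
      ENNReal.ofReal_natCast, ENNReal.ofReal_natCast] at h3
    simpa using h3
  have h2 : (2 : ℝ≥0∞) ^ (-A * ((⌈R⌉₊ + t : ℕ) : ℝ)) ≤ 2 ^ (-A * (t : ℝ)) * 2 ^ (-A * R) := by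
    rw [← two_rpow_add]
    refine two_rpow_le ?_
    push_cast
    nlinarith [Nat.le_ceil R]
  calc _ ≤ 3 ^ (Fintype.card ι - 1) * (((t + 1) ^ (Fintype.card ι - 1) : ℕ) : ℝ≥0∞) *
        ENNReal.ofReal R ^ (Fintype.card ι - 1) * (2 ^ (-A * (t : ℝ)) * 2 ^ (-A * R)) :=
        mul_le_mul' h1 h2
    _ = _ := by ring

/-! ### Inverse weights outside the hyperbolic cross -/

theorem dyadicLevel_eq_of_mem_dyadicBlock {k : ℤ} {j : ℕ} (h : k ∈ dyadicBlock j) :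
    dyadicLevel k = j := by
  refine le_antisymm (dyadicLevel_le (natAbs_le_of_mem_dyadicBlock h)) ?_
  rcases Nat.eq_zero_or_pos j with h0 | h0
  · omega
  · have h1 : 2 ^ (j - 1) < k.natAbs := by
      rw [dyadicBlock, if_neg h0.ne'] at h
      have h2 : (0 : ℤ) < 2 ^ (j - 1) := by positivity
      zify
      rw [lt_abs]
      simp only [Set.mem_union, Set.mem_Icc] at h
      rcases h with h | h
      · right; linarith
      · left; linarith
    have h2 : j - 1 < dyadicLevel k := (Nat.lt_clog_iff_pow_lt one_lt_two).2 h1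
    omega

theorem mem_hyperbolicCross_iff {d : ℕ} {T R : ℝ} {k : Fin d → ℤ} :
    k ∈ hyperbolicCross d T R ↔ (fun s => dyadicLevel (k s)) ∈ levelSet d T R := by
  simp only [hyperbolicCross, Set.mem_iUnion, Set.mem_ofPred_eq, exists_prop]
  constructor
  · rintro ⟨j, hj, hk⟩
    have : (fun s => dyadicLevel (k s)) = j :=
      funext fun s => dyadicLevel_eq_of_mem_dyadicBlock (hk s)
    rwa [this]
  · exact fun h => ⟨_, h, fun s => mem_dyadicBlock_dyadicLevel (k s)⟩

theorem weight_pos {d : ℕ} (α β : ℝ) (k : Fin d → ℤ) : 0 < weight α β k := by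
  unfold weight
  have : ∀ s, 0 < (1 + (k s : ℝ) ^ 2) ^ α := fun s => by positivity
  exact mul_pos (by positivity) (Finset.prod_pos fun s _ => this s)

/-- Since `β ≤ 0`, the isotropic factor calls for the upper bound `1 + ‖k‖₂² ≤ (1 + d) 4^m` with `m`
the largest level. Since `α ≥ 0`, the product factors call for lower bounds; the loss `1 / 4` comes
from `|k_s| > 2^(j_s - 1)`. -/
theorem le_weight {d : ℕ} {α β : ℝ} (hα : 0 ≤ α) (hβ : β ≤ 0) (k : Fin d → ℤ) :
    (1 + (d : ℝ)) ^ β * ((1 / 4 : ℝ) ^ α) ^ d *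
      2 ^ (2 * α * ((∑ s, dyadicLevel (k s) : ℕ) : ℝ) +
        2 * β * ((Finset.univ.sup fun s => dyadicLevel (k s) : ℕ) : ℝ)) ≤ weight α β k := by
  set m := Finset.univ.sup fun s => dyadicLevel (k s) with hm
  have hk : ∀ s, (k s : ℝ) ^ 2 ≤ 2 ^ (2 * m) := fun s => by
    have h1 : (k s).natAbs ≤ 2 ^ m := (natAbs_le_two_pow_dyadicLevel _).trans
      (Nat.pow_le_pow_right two_pos
        (Finset.le_sup (f := fun s => dyadicLevel (k s)) (Finset.mem_univ s)))
    have h2 : |(k s : ℝ)| ≤ 2 ^ m := by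
      rw [← Int.cast_abs, ← Int.natCast_natAbs]
      exact_mod_cast h1
    rw [mul_comm, pow_mul, ← sq_abs]
    exact pow_le_pow_left₀ (abs_nonneg _) h2 2
  have h1 : (1 + (d : ℝ)) ^ β * 2 ^ (2 * β * (m : ℝ)) ≤ (1 + ∑ s, (k s : ℝ) ^ 2) ^ β := by
    have h2 : 1 + ∑ s, (k s : ℝ) ^ 2 ≤ (1 + (d : ℝ)) * 2 ^ (2 * m) := by
      have h3 : ∑ s, (k s : ℝ) ^ 2 ≤ d * 2 ^ (2 * m) := by
        simpa using Finset.sum_le_card_nsmul Finset.univ _ _ fun s _ => hk s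
      have h4 : (1 : ℝ) ≤ 2 ^ (2 * m) := one_le_pow₀ (by norm_num)
      linarith
    refine le_trans (le_of_eq ?_) (Real.rpow_le_rpow_of_nonpos (by positivity) h2 hβ)
    rw [Real.mul_rpow (by positivity) (by positivity), ← Real.rpow_natCast,
      ← Real.rpow_mul zero_le_two]
    congr 2
    push_cast
    ring
  have h2 : ((1 / 4 : ℝ) ^ α) ^ d * 2 ^ (2 * α * ((∑ s, dyadicLevel (k s) : ℕ) : ℝ)) ≤
      ∏ s, (1 + (k s : ℝ) ^ 2) ^ α := by
    have h3 : ((1 / 4 : ℝ) ^ α) ^ d * 2 ^ (2 * α * ((∑ s, dyadicLevel (k s) : ℕ) : ℝ)) =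
        ∏ s, ((1 / 4 : ℝ) ^ α * 2 ^ (2 * α * (dyadicLevel (k s) : ℝ))) := by
      rw [Finset.prod_mul_distrib, Finset.prod_const, Finset.card_univ, Fintype.card_fin]
      congr 1
      push_cast
      rw [Finset.mul_sum, Real.rpow_sum_of_pos two_pos]
    rw [h3]
    refine Finset.prod_le_prod (fun s _ => by positivity) fun s _ => ?_
    have h4 : 1 / 4 * 2 ^ (2 * dyadicLevel (k s)) ≤ 1 + (k s : ℝ) ^ 2 := by
      by_cases h0 : dyadicLevel (k s) = 0
      · rw [h0]
        norm_num
        nlinarith [sq_nonneg (k s : ℝ)]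
      · have h5 : (2 : ℝ) ^ (dyadicLevel (k s) - 1) ≤ |(k s : ℝ)| := by
          rw [← Int.cast_abs, ← Int.natCast_natAbs]
          exact_mod_cast (two_pow_lt_natAbs h0).le
        have h6 := pow_le_pow_left₀ (by positivity) h5 2
        rw [sq_abs] at h6
        obtain ⟨n, hn⟩ := Nat.exists_eq_succ_of_ne_zero h0
        rw [hn] at h6 ⊢
        simp only [Nat.succ_eq_add_one, Nat.add_sub_cancel] at h6 ⊢
        rw [← pow_mul, mul_comm n 2] at h6
        rw [show 2 * (n + 1) = 2 * n + 2 by ring, pow_add]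
        linarith
    refine le_trans (le_of_eq ?_) (Real.rpow_le_rpow (by positivity) h4 hα)
    rw [Real.mul_rpow (by positivity) (by positivity), ← Real.rpow_natCast,
      ← Real.rpow_mul zero_le_two]
    congr 2
    push_cast
    ring
  calc _ = ((1 + (d : ℝ)) ^ β * 2 ^ (2 * β * (m : ℝ))) *
        (((1 / 4 : ℝ) ^ α) ^ d * 2 ^ (2 * α * ((∑ s, dyadicLevel (k s) : ℕ) : ℝ))) := by
        rw [Real.rpow_add two_pos]
        ring
    _ ≤ _ := mul_le_mul h1 h2 (by positivity) (by positivity)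

theorem exists_inv_weight_le (d : ℕ) {α β : ℝ} (hα : 0 ≤ α) (hβ : β ≤ 0) :
    ∃ K : ℝ≥0∞, K ≠ ⊤ ∧ ∀ k : Fin d → ℤ, (ENNReal.ofReal (weight α β k))⁻¹ ≤
      K * 2 ^ (-(2 * α) * ((∑ s, dyadicLevel (k s) : ℕ) : ℝ) -
        2 * β * ((Finset.univ.sup fun s => dyadicLevel (k s) : ℕ) : ℝ)) := by
  have hc : 0 < (1 + (d : ℝ)) ^ β * ((1 / 4 : ℝ) ^ α) ^ d := by positivity
  refine ⟨ENNReal.ofReal ((1 + (d : ℝ)) ^ β * ((1 / 4 : ℝ) ^ α) ^ d)⁻¹, ENNReal.ofReal_ne_top,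
    fun k => ?_⟩
  rw [← ENNReal.ofReal_inv_of_pos (weight_pos α β k), ← ofReal_two_rpow,
    ← ENNReal.ofReal_mul (by positivity)]
  refine ENNReal.ofReal_le_ofReal ?_
  refine (inv_anti₀ (by positivity) (le_weight hα hβ k)).trans_eq ?_
  rw [mul_inv, ← Real.rpow_neg zero_le_two]
  congr 2
  ring

/-- This is the square of the truncation rate. The block size `2^‖j‖₁` lowers the decay exponent
`2α` to `B = 2α - 1`, and along a coordinate axis the decay is `A = 2(α + β) - 1`. -/
theorem exists_tsum_inv_weight_le {d : ℕ} (hd : 2 ≤ d) {α β : ℝ} (hα : 1 / 2 < α) (hβ : β ≤ 0)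
    (hαβ : 1 / 2 < α + β) :
    ∃ K : ℝ≥0∞, K ≠ ⊤ ∧ ∀ R : ℝ, 1 ≤ R → ∀ I : Finset (Fin d → ℤ),
      (I : Set (Fin d → ℤ)) = hyperbolicCross d (-β / α) R →
      ∑' k : Fin d → ℤ, (if k ∈ I then 0 else (ENNReal.ofReal (weight α β k))⁻¹) ≤
        K * (2 ^ (-(2 * (α + β) - 1) * R) *
          (if β = 0 then ENNReal.ofReal R ^ (d - 1) else 1)) := by
  obtain ⟨K, hK, hw⟩ := exists_inv_weight_le d (α := α) (by linarith) hβ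
  have : Nontrivial (Fin d) := Fin.nontrivial_iff_two_le.2 hd
  have hd' : (2 : ℝ) ≤ d := by exact_mod_cast hd
  set T := -β / α with hTdef
  have hT1 : T < 1 := by
    rw [hTdef, div_lt_one (by linarith)]
    linarith
  have hA : 0 < 2 * (α + β) - 1 := by linarith
  have hmain : ∀ R : ℝ, 1 ≤ R → ∀ I : Finset (Fin d → ℤ),
      (I : Set (Fin d → ℤ)) = hyperbolicCross d T R →
      ∑' k : Fin d → ℤ, (if k ∈ I then 0 else (ENNReal.ofReal (weight α β k))⁻¹) ≤
        K * (3 ^ d * ∑' j : Fin d → ℕ,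
          (if (1 - T) * R ≤ ((∑ i, j i : ℕ) : ℝ) - T * ((Finset.univ.sup j : ℕ) : ℝ)
          then (2 : ℝ≥0∞) ^ (-(2 * α - 1) * ((∑ i, j i : ℕ) : ℝ) +
            ((2 * α - 1) - (2 * (α + β) - 1)) * ((Finset.univ.sup j : ℕ) : ℝ))
          else 0)) := by
    intro R hR I hI
    have h1 := tsum_comp_dyadicLevel_le (ι := Fin d) fun j =>
      if (1 - T) * R ≤ ((∑ i, j i : ℕ) : ℝ) - T * ((Finset.univ.sup j : ℕ) : ℝ)
      then (2 : ℝ≥0∞) ^ (-(2 * α) * ((∑ i, j i : ℕ) : ℝ) -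
        2 * β * ((Finset.univ.sup j : ℕ) : ℝ)) else 0
    rw [Fintype.card_fin] at h1
    have h2 : ∀ j : Fin d → ℕ, (2 : ℝ≥0∞) ^ (∑ i, j i) *
        (if (1 - T) * R ≤ ((∑ i, j i : ℕ) : ℝ) - T * ((Finset.univ.sup j : ℕ) : ℝ)
        then (2 : ℝ≥0∞) ^ (-(2 * α) * ((∑ i, j i : ℕ) : ℝ) -
          2 * β * ((Finset.univ.sup j : ℕ) : ℝ)) else 0) =
        (if (1 - T) * R ≤ ((∑ i, j i : ℕ) : ℝ) - T * ((Finset.univ.sup j : ℕ) : ℝ)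
          then (2 : ℝ≥0∞) ^ (-(2 * α - 1) * ((∑ i, j i : ℕ) : ℝ) +
            ((2 * α - 1) - (2 * (α + β) - 1)) * ((Finset.univ.sup j : ℕ) : ℝ))
          else 0) := fun j => by
      rw [← ENNReal.rpow_natCast, mul_ite, mul_zero, ← two_rpow_add]
      congr 2
      ring
    rw [tsum_congr h2] at h1
    refine le_trans ?_ (mul_le_mul_right h1 K)
    rw [← ENNReal.tsum_mul_left]
    refine ENNReal.tsum_le_tsum fun k => ?_
    by_cases hk : k ∈ I
    · rw [if_pos hk]
      exact zero_le
    · rw [if_neg hk, if_pos]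
      · exact hw k
      -- Outside the cross the offset `d - 1 ≥ 0` in the level condition can be discarded.
      · rw [← Finset.mem_coe, hI, mem_hyperbolicCross_iff, levelSet, Set.mem_ofPred_eq,
          not_le] at hk
        linarith
  rcases eq_or_lt_of_le hβ with hβ0 | hβ0
  · have hT0 : T = 0 := by rw [hTdef, hβ0]; simp
    refine ⟨K * (3 ^ d * (3 ^ (d - 1) * geomMoment (d - 1) (2 * (α + β) - 1))), ?_, ?_⟩
    · have := geomMoment_ne_top (d - 1) hA
      finiteness
    · intro R hR I hI
      refine (hmain R hR I hI).trans ?_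
      rw [if_pos hβ0, mul_assoc, mul_assoc]
      refine mul_le_mul_right (mul_le_mul_right ?_ _) _
      have h1 := tsum_compl_simplex_le (ι := Fin d) hA hR
      rw [Fintype.card_fin, mul_comm (ENNReal.ofReal R ^ (d - 1))] at h1
      refine le_trans (le_of_eq (tsum_congr fun j => ?_)) h1
      rw [hT0, hβ0]
      simp
  · have hT0 : 0 < T := div_pos (by linarith) (by linarith)
    refine ⟨K * (3 ^ d * (d * (geomMoment 0 (2 * (α + β) - 1) *
      geomMoment (d - 2) (T / (1 - T))))), ?_, ?_⟩
    · have := geomMoment_ne_top 0 hA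
      have := geomMoment_ne_top (d - 2) (div_pos hT0 (by linarith : 0 < 1 - T))
      finiteness
    · intro R hR I hI
      refine (hmain R hR I hI).trans ?_
      rw [if_neg hβ0.ne, mul_assoc, mul_assoc, mul_one]
      refine mul_le_mul_right (mul_le_mul_right ?_ _) _
      have h1 := tsum_compl_levelSet_le (ι := Fin d) (B := 2 * α - 1) hT1 hA
        -- `B (1 - T) = (2α - 1)(1 + β/α) = 2(α + β) - 1 - β/α = A + T`.
        (by rw [hTdef]; field_simp; ring) R
      rw [Fintype.card_fin] at h1
      exact h1

/-! ### Cardinalities of the cross and of its difference set -/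

theorem natCast_card_eq_tsum {A : Type*} (s : Finset A) :
    (s.card : ℝ≥0∞) = ∑' a, Set.indicator (s : Set A) 1 a := by
  rw [tsum_eq_sum (s := s) fun a ha => Set.indicator_of_notMem (by simpa using ha) _,
    Finset.card_eq_sum_ones, Nat.cast_sum]
  exact Finset.sum_congr rfl fun a ha => by
    rw [Set.indicator_of_mem (by simpa using ha)]
    simp

theorem tsum_simplex_le {ι : Type*} [Fintype ι] [Nonempty ι] (N : ℕ) :
    ∑' j : ι → ℕ, (if ∑ i, j i ≤ N then (2 : ℝ≥0∞) ^ (∑ i, j i) else 0) ≤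
      ((N + 1) ^ (Fintype.card ι - 1) * 2 ^ (N + 1) : ℕ) := by
  refine (tsum_comp_sum_le fun b => if b ≤ N then (2 : ℝ≥0∞) ^ b else 0).trans ?_
  rw [tsum_eq_sum (s := Finset.range (N + 1))]
  · calc ∑ b ∈ Finset.range (N + 1), (((b + 1) ^ (Fintype.card ι - 1) : ℕ) : ℝ≥0∞) *
          (if b ≤ N then (2 : ℝ≥0∞) ^ b else 0)
        ≤ ∑ b ∈ Finset.range (N + 1), (((N + 1) ^ (Fintype.card ι - 1) * 2 ^ b : ℕ) : ℝ≥0∞) := by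
          refine Finset.sum_le_sum fun b hb => ?_
          have hb' : b ≤ N := Nat.lt_succ_iff.1 (Finset.mem_range.1 hb)
          rw [if_pos hb']
          push_cast
          gcongr
      _ ≤ _ := by
          rw [← Nat.cast_sum, ← Finset.mul_sum]
          exact_mod_cast Nat.mul_le_mul_left _
            (Nat.geomSum_lt le_rfl fun k hk => by simpa using hk).le
  · intro b hb
    rw [if_neg, mul_zero]
    simpa using hb

/-- The sum factors over the two groups of coordinates, and each nonempty group saves one power of
`N + 1`, whence the exponent `card ι - 2`. -/
theorem tsum_prod_simplex_le {ι : Type*} [Fintype ι] [Nontrivial ι] (p : ι → Prop)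
    [DecidablePred p] (N : ℕ) :
    ∑' j : ι → ℕ, (if ∑ i : {i // p i}, j i ≤ N ∧ ∑ i : {i // ¬ p i}, j i ≤ N
      then (2 : ℝ≥0∞) ^ (∑ i, j i) else 0) ≤
      ((N + 1) ^ (Fintype.card ι - 2) * 2 ^ (2 * N + 2) : ℕ) := by
  have h1 : ∀ j : ι → ℕ, (if ∑ i : {i // p i}, j i ≤ N ∧ ∑ i : {i // ¬ p i}, j i ≤ N
      then (2 : ℝ≥0∞) ^ (∑ i, j i) else 0) =
      (fun q : ({i // p i} → ℕ) × ({i // ¬ p i} → ℕ) =>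
        (if ∑ i, q.1 i ≤ N then (2 : ℝ≥0∞) ^ (∑ i, q.1 i) else 0) *
        (if ∑ i, q.2 i ≤ N then (2 : ℝ≥0∞) ^ (∑ i, q.2 i) else 0))
        (Equiv.piEquivPiSubtypeProd p (fun _ => ℕ) j) := by
    intro j
    simp only [Equiv.piEquivPiSubtypeProd_apply]
    rw [← Fintype.sum_subtype_add_sum_subtype p j, pow_add]
    split_ifs <;> simp_all
  rw [tsum_congr h1]
  refine (Equiv.tsum_eq (Equiv.piEquivPiSubtypeProd p fun _ => ℕ)
    fun q : ({i // p i} → ℕ) × ({i // ¬ p i} → ℕ) =>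
        (if ∑ i, q.1 i ≤ N then (2 : ℝ≥0∞) ^ (∑ i, q.1 i) else 0) *
        (if ∑ i, q.2 i ≤ N then (2 : ℝ≥0∞) ^ (∑ i, q.2 i) else 0)).trans_le ?_
  rw [ENNReal.tsum_prod']
  simp only [ENNReal.tsum_mul_left, ENNReal.tsum_mul_right]
  have hcard : Fintype.card {i // p i} + Fintype.card {i // ¬ p i} = Fintype.card ι := by
    rw [← Fintype.card_sum]
    exact Fintype.card_congr (Equiv.sumCompl p)
  have h2 : 2 ≤ Fintype.card ι := Fintype.one_lt_card
  have h3 : N + 1 ≤ 2 ^ (N + 1) := Nat.lt_two_pow_self.le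
  -- If one group is empty, only one power is saved, but a whole factor `2^(N+1)` is to spare and
  -- absorbs the extra `N + 1`.
  have h4 : (N + 1) ^ (Fintype.card ι - 1) * 2 ^ (N + 1) ≤
      (N + 1) ^ (Fintype.card ι - 2) * 2 ^ (2 * N + 2) := by
    rw [show Fintype.card ι - 1 = Fintype.card ι - 2 + 1 by omega,
      show 2 * N + 2 = (N + 1) + (N + 1) by ring, pow_succ, pow_add 2 (N + 1), mul_assoc]
    gcongr
  rcases isEmpty_or_nonempty {i // p i} with hp | hp
  · have h0 : Fintype.card {i // p i} = 0 := Fintype.card_eq_zero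
    have : Nonempty {i // ¬ p i} := Fintype.card_pos_iff.1 (by omega)
    have h5 := tsum_simplex_le (ι := {i // ¬ p i}) N
    rw [show Fintype.card {i // ¬ p i} = Fintype.card ι by omega] at h5
    refine le_trans ?_ (h5.trans (Nat.cast_le.2 h4))
    simp
  rcases isEmpty_or_nonempty {i // ¬ p i} with hn | hn
  · have h0 : Fintype.card {i // ¬ p i} = 0 := Fintype.card_eq_zero
    have h5 := tsum_simplex_le (ι := {i // p i}) N
    rw [show Fintype.card {i // p i} = Fintype.card ι by omega] at h5
    refine le_trans ?_ (h5.trans (Nat.cast_le.2 h4))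
    simp
  · have h5 := Fintype.card_pos (α := {i // p i})
    have h6 := Fintype.card_pos (α := {i // ¬ p i})
    refine (mul_le_mul' (tsum_simplex_le (ι := {i // p i}) N)
      (tsum_simplex_le (ι := {i // ¬ p i}) N)).trans_eq ?_
    rw [← Nat.cast_mul]
    congr 1
    rw [show Fintype.card ι - 2 = (Fintype.card {i // p i} - 1) +
      (Fintype.card {i // ¬ p i} - 1) by omega, pow_add, show 2 * N + 2 = (N + 1) + (N + 1) by ring,
      pow_add]
    ring

theorem dyadicLevel_sub_le (a b : ℤ) :
    dyadicLevel (a - b) ≤ max (dyadicLevel a) (dyadicLevel b) + 1 := by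
  refine dyadicLevel_le ?_
  have h1 := (natAbs_le_two_pow_dyadicLevel a).trans
    (Nat.pow_le_pow_right two_pos (le_max_left _ (dyadicLevel b)))
  have h2 := (natAbs_le_two_pow_dyadicLevel b).trans
    (Nat.pow_le_pow_right two_pos (le_max_right (dyadicLevel a) _))
  have h3 := Int.natAbs_sub_le a b
  rw [pow_succ]
  omega

/-- Each level of `h - h'` exceeds the larger of the two levels by at most one; the `+ d` in `hI`
pays for these increments. On the coordinates where `h` dominates, the levels of the difference sum
to at most `N`, and likewise where `h'` dominates. The factor `2^d` counts the domination patterns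
`u`. -/
theorem card_differenceSet_le {d N : ℕ} (hd : 2 ≤ d) {I : Finset (Fin d → ℤ)}
    (hI : ∀ k ∈ I, ∑ s, dyadicLevel (k s) + d ≤ N) :
    (differenceSet I).card ≤ 2 ^ d * (3 ^ d * ((N + 1) ^ (d - 2) * 2 ^ (2 * N + 2))) := by
  classical
  have : Nontrivial (Fin d) := Fin.nontrivial_iff_two_le.2 hd
  set G : (Fin d → Bool) → (Fin d → ℕ) → ℝ≥0∞ := fun u j =>
    if ∑ i : {i // u i = true}, j i ≤ N ∧ ∑ i : {i // ¬ u i = true}, j i ≤ N then 1 else 0 with hG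
  have h1 : ((differenceSet I).card : ℝ≥0∞) ≤
      ∑ u : Fin d → Bool, ∑' k : Fin d → ℤ, G u fun s => dyadicLevel (k s) := by
    rw [natCast_card_eq_tsum, ← Summable.tsum_finsetSum fun _ _ => ENNReal.summable]
    refine ENNReal.tsum_le_tsum fun k => Set.indicator_apply_le' (fun hk => ?_) fun _ => zero_le
    obtain ⟨h, hh, h', hh', rfl⟩ := Finset.mem_image₂.1 (Finset.mem_coe.1 hk)
    set u : Fin d → Bool := fun s => decide (dyadicLevel (h' s) ≤ dyadicLevel (h s)) with hu
    refine le_trans ?_ (Finset.single_le_sum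
      (f := fun u => G u fun s => dyadicLevel ((h - h') s)) (fun _ _ => zero_le)
      (Finset.mem_univ u))
    have key : ∀ (p : Fin d → Prop) [DecidablePred p] (g : Fin d → ℤ), g ∈ I →
        (∀ i, p i → dyadicLevel ((h - h') i) ≤ dyadicLevel (g i) + 1) →
        ∑ i : {i // p i}, dyadicLevel ((h - h') i) ≤ N := by
      intro p _ g hg hp
      calc ∑ i : {i // p i}, dyadicLevel ((h - h') i)
          ≤ ∑ i : {i // p i}, (dyadicLevel (g i) + 1) := Finset.sum_le_sum fun i _ => hp i i.2
        _ ≤ ∑ i : {i // p i}, (dyadicLevel (g i) + 1) +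
            ∑ i : {i // ¬ p i}, (dyadicLevel (g i) + 1) := Nat.le_add_right _ _
        _ = ∑ i, (dyadicLevel (g i) + 1) :=
            Fintype.sum_subtype_add_sum_subtype p fun i => dyadicLevel (g i) + 1
        _ ≤ N := by
            rw [Finset.sum_add_distrib]
            simpa using hI g hg
    rw [hG]
    simp only
    rw [if_pos]
    · rfl
    · refine ⟨key (u · = true) h hh fun i hi => ?_, key (¬ u · = true) h' hh' fun i hi => ?_⟩
      · have h2 := dyadicLevel_sub_le (h i) (h' i)
        rwa [max_eq_left (of_decide_eq_true hi)] at h2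
      · have h2 := dyadicLevel_sub_le (h i) (h' i)
        rwa [max_eq_right (not_le.1 fun hle => hi (decide_eq_true hle)).le] at h2
  have h2 : ∀ u ∈ (Finset.univ : Finset (Fin d → Bool)),
      ∑' k : Fin d → ℤ, G u (fun s => dyadicLevel (k s)) ≤
        ((3 ^ d * ((N + 1) ^ (d - 2) * 2 ^ (2 * N + 2)) : ℕ) : ℝ≥0∞) := by
    intro u _
    refine (tsum_comp_dyadicLevel_le (G u)).trans ?_
    have h3 := tsum_prod_simplex_le (fun i => u i = true) N
    rw [Fintype.card_fin] at h3 ⊢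
    rw [Nat.cast_mul, Nat.cast_pow]
    refine mul_le_mul_right (le_trans (le_of_eq (tsum_congr fun j => ?_)) h3) _
    rw [hG]
    simp only [mul_ite, mul_one, mul_zero]
  have h3 := h1.trans (Finset.sum_le_card_nsmul _ _ _ h2)
  rw [Finset.card_univ, Fintype.card_fun, Fintype.card_bool, Fintype.card_fin, nsmul_eq_mul, ← Nat.cast_mul] at h3
  exact_mod_cast h3

theorem exists_card_le {d : ℕ} (hd : 2 ≤ d) {T : ℝ} (hT0 : 0 < T) (hT1 : T < 1) :
    ∃ K : ℝ, 0 ≤ K ∧ ∀ (R : ℝ) (I : Finset (Fin d → ℤ)),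
      (I : Set (Fin d → ℤ)) = hyperbolicCross d T R → (I.card : ℝ) ≤ K * 2 ^ R := by
  have : Nontrivial (Fin d) := Fin.nontrivial_iff_two_le.2 hd
  set K : ℝ≥0∞ := 3 ^ d * (d * (2 * 2 ^ (((d : ℝ) - 1) / (1 - T)) *
    geomMoment (d - 2) (T / (1 - T)))) with hK
  have hKtop : K ≠ ⊤ := by
    have := geomMoment_ne_top (d - 2) (div_pos hT0 (by linarith : 0 < 1 - T))
    have := two_rpow_ne_top (((d : ℝ) - 1) / (1 - T))
    finiteness
  refine ⟨K.toReal, ENNReal.toReal_nonneg, fun R I hI => ?_⟩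
  have h1 : (I.card : ℝ≥0∞) ≤ K * 2 ^ R := by
    rw [natCast_card_eq_tsum]
    have h2 := tsum_levelSet_le (ι := Fin d) hT1 ((d : ℝ) - 1) R
    rw [Fintype.card_fin] at h2
    have h3 := tsum_comp_dyadicLevel_le (ι := Fin d) fun j =>
      if ((∑ i, j i : ℕ) : ℝ) - T * ((Finset.univ.sup j : ℕ) : ℝ) ≤ (1 - T) * R + ((d : ℝ) - 1)
      then 1 else 0
    simp only [mul_ite, mul_one, mul_zero, ← ENNReal.rpow_natCast, Fintype.card_fin] at h3
    refine le_trans ?_ (h3.trans ((mul_le_mul_right h2 _).trans_eq ?_))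
    · refine ENNReal.tsum_le_tsum fun k => Set.indicator_apply_le' (fun hk => ?_) fun _ => zero_le
      rw [hI, mem_hyperbolicCross_iff, levelSet, Set.mem_ofPred_eq] at hk
      rw [if_pos (by linarith)]
      rfl
    · rw [hK, ENNReal.rpow_natCast]
      ring
  have h2 := ENNReal.toReal_mono (ENNReal.mul_ne_top hKtop (two_rpow_ne_top R)) h1
  rwa [ENNReal.toReal_mul, ← ofReal_two_rpow, ENNReal.toReal_ofReal (by positivity),
    ENNReal.toReal_natCast] at h2

/-- The width is really `O(2^R)`; the weaker `2^(2 * R)` matches the bound for the difference set.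
-/
theorem boxWidth_succ_le {d : ℕ} {T R : ℝ} (hT1 : T < 1) (hR : 1 ≤ R) (hd : 1 ≤ d)
    {I : Finset (Fin d → ℤ)} (hI : (I : Set (Fin d → ℤ)) = hyperbolicCross d T R) :
    ((boxWidth I + 1 : ℕ) : ℝ) ≤ 3 * 2 ^ (((d : ℝ) - 1) / (1 - T)) * 2 ^ (2 * R) := by
  have hT : 0 < 1 - T := by linarith
  have hd' : (1 : ℝ) ≤ d := by exact_mod_cast hd
  set X : ℝ := 2 ^ (R + ((d : ℝ) - 1) / (1 - T)) with hX
  have h0 : 0 ≤ ((d : ℝ) - 1) / (1 - T) := div_nonneg (by linarith) hT.le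
  have hX1 : 1 ≤ X := Real.one_le_rpow (by norm_num) (by linarith)
  have h1 : ∀ k ∈ I, ∀ s, ((k s).natAbs : ℝ) ≤ X := by
    intro k hk s
    rw [← Finset.mem_coe, hI, mem_hyperbolicCross_iff, levelSet, Set.mem_ofPred_eq] at hk
    set j : Fin d → ℕ := fun s => dyadicLevel (k s) with hj
    have h2 : (j s : ℝ) ≤ ((Finset.univ.sup j : ℕ) : ℝ) := by
      exact_mod_cast Finset.le_sup (Finset.mem_univ s)
    have h3 : ((Finset.univ.sup j : ℕ) : ℝ) ≤ ((∑ s, j s : ℕ) : ℝ) := by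
      exact_mod_cast Finset.sup_le fun i _ => Finset.single_le_sum (f := j)
        (fun _ _ => Nat.zero_le _) (Finset.mem_univ i)
    -- `(1 - T) j_s ≤ (1 - T) ‖j‖_∞ ≤ ‖j‖₁ - T ‖j‖_∞`.
    have h4 : (j s : ℝ) ≤ R + ((d : ℝ) - 1) / (1 - T) := by
      rw [← sub_le_iff_le_add', le_div_iff₀ hT]
      nlinarith [mul_le_mul_of_nonneg_left h2 hT.le]
    calc ((k s).natAbs : ℝ) ≤ 2 ^ (j s) := by exact_mod_cast natAbs_le_two_pow_dyadicLevel (k s)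
      _ = 2 ^ ((j s : ℕ) : ℝ) := (Real.rpow_natCast _ _).symm
      _ ≤ X := Real.rpow_le_rpow_of_exponent_le (by norm_num) h4
  have h2 : boxWidth I ≤ ⌊2 * X⌋₊ := by
    refine Finset.sup_le fun k hk => Finset.sup_le fun s _ => Nat.le_floor ?_
    obtain ⟨h, hh, h', hh', rfl⟩ := Finset.mem_image₂.1 hk
    have h3 : (((h - h') s).natAbs : ℝ) ≤ ((h s).natAbs : ℝ) + ((h' s).natAbs : ℝ) := by
      exact_mod_cast Int.natAbs_sub_le (h s) (h' s)
    linarith [h1 h hh s, h1 h' hh' s]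
  have h3 : (boxWidth I : ℝ) ≤ 2 * X :=
    (Nat.cast_le.2 h2).trans (Nat.floor_le (by linarith))
  have h4 : X ≤ 2 ^ (((d : ℝ) - 1) / (1 - T)) * 2 ^ (2 * R) := by
    rw [hX, ← Real.rpow_add two_pos]
    exact Real.rpow_le_rpow_of_exponent_le (by norm_num) (by linarith)
  push_cast
  linarith

theorem exists_max_card_differenceSet_boxWidth_le {d : ℕ} (hd : 2 ≤ d) {T : ℝ} (hT0 : 0 ≤ T)
    (hT1 : T < 1) :
    ∃ K : ℝ, 0 < K ∧ ∀ R : ℝ, 1 ≤ R → ∀ I : Finset (Fin d → ℤ),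
      (I : Set (Fin d → ℤ)) = hyperbolicCross d T R →
      ((max (differenceSet I).card (boxWidth I + 1) : ℕ) : ℝ) ≤
        K * (2 ^ (2 * R) * (if T = 0 then R ^ (d - 2) else 1)) := by
  set W : ℝ := 3 * 2 ^ (((d : ℝ) - 1) / (1 - T)) with hW
  have hW0 : 0 < W := by positivity
  suffices h : ∃ K : ℝ, 0 ≤ K ∧ ∀ R : ℝ, 1 ≤ R → ∀ I : Finset (Fin d → ℤ),
      (I : Set (Fin d → ℤ)) = hyperbolicCross d T R →
      ((differenceSet I).card : ℝ) ≤ K * (2 ^ (2 * R) * (if T = 0 then R ^ (d - 2) else 1)) by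
    obtain ⟨K, hK0, hK⟩ := h
    refine ⟨K + W, by positivity, fun R hR I hI => ?_⟩
    have h1 : (1 : ℝ) ≤ if T = 0 then R ^ (d - 2) else 1 := by
      split_ifs
      · exact one_le_pow₀ hR
      · exact le_rfl
    have h2 : (0 : ℝ) < 2 ^ (2 * R) := by positivity
    have h3 := hK R hR I hI
    have h4 := boxWidth_succ_le hT1 hR (by omega) hI
    rw [← hW] at h4
    rw [Nat.cast_max, max_le_iff, add_mul]
    constructor
    · exact h3.trans (le_add_of_nonneg_right (by positivity))
    · refine h4.trans ?_
      have h5 : W * 2 ^ (2 * R) ≤ W * (2 ^ (2 * R) * if T = 0 then R ^ (d - 2) else 1) :=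
        mul_le_mul_of_nonneg_left (le_mul_of_one_le_right h2.le h1) hW0.le
      exact h5.trans (le_add_of_nonneg_left (by positivity))
  rcases eq_or_lt_of_le hT0 with hT | hT
  · refine ⟨2 ^ d * (3 ^ d * ((2 + 2 * d) ^ (d - 2) * 2 ^ (4 * d + 2))), by positivity,
      fun R hR I hI => ?_⟩
    rw [if_pos hT.symm]
    -- One `d` covers the offset in the level set, the other the `+ d` required by
    -- `card_differenceSet_le`.
    set N : ℕ := ⌊R⌋₊ + 2 * d with hN
    have h1 : (differenceSet I).card ≤
        2 ^ d * (3 ^ d * ((N + 1) ^ (d - 2) * 2 ^ (2 * N + 2))) := by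
      refine card_differenceSet_le hd fun k hk => ?_
      rw [← Finset.mem_coe, hI, mem_hyperbolicCross_iff, levelSet, Set.mem_ofPred_eq, ← hT] at hk
      have h2 : ∑ s, dyadicLevel (k s) - d ≤ ⌊R⌋₊ := by
        rw [Nat.sub_le_iff_le_add, ← Nat.floor_add_natCast (by linarith)]
        exact Nat.le_floor (by linarith)
      omega
    have h2 : ((N + 1 : ℕ) : ℝ) ≤ (2 + 2 * d) * R := by
      have := Nat.floor_le (by linarith : 0 ≤ R)
      have hd0 : (0 : ℝ) ≤ d := Nat.cast_nonneg d
      rw [hN]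
      push_cast
      nlinarith
    have h3 : (2 : ℝ) ^ (2 * N + 2) ≤ 2 ^ (4 * d + 2) * 2 ^ (2 * R) := by
      rw [← Real.rpow_natCast, ← Real.rpow_natCast, ← Real.rpow_add two_pos]
      refine Real.rpow_le_rpow_of_exponent_le (by norm_num) ?_
      have := Nat.floor_le (by linarith : 0 ≤ R)
      rw [hN]
      push_cast
      linarith
    have h4 : ((differenceSet I).card : ℝ) ≤
        2 ^ d * (3 ^ d * (((N + 1 : ℕ) : ℝ) ^ (d - 2) * 2 ^ (2 * N + 2))) := by exact_mod_cast h1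
    calc ((differenceSet I).card : ℝ)
        ≤ 2 ^ d * (3 ^ d * (((N + 1 : ℕ) : ℝ) ^ (d - 2) * 2 ^ (2 * N + 2))) := h4
      _ ≤ 2 ^ d * (3 ^ d * (((2 + 2 * d) * R) ^ (d - 2) * (2 ^ (4 * d + 2) * 2 ^ (2 * R)))) := by
          gcongr
      _ = _ := by
          rw [mul_pow]
          ring
  -- Here `|I| = O(2^R)` carries no logarithm, so the trivial bound `|𝒟(I)| ≤ |I|²` suffices.
  · obtain ⟨K, hK0, hK⟩ := exists_card_le hd hT hT1
    refine ⟨K ^ 2, by positivity, fun R hR I hI => ?_⟩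
    rw [if_neg hT.ne', mul_one]
    have h1 : (differenceSet I).card ≤ I.card * I.card := Finset.card_image₂_le _ _ _
    have h2 : ((differenceSet I).card : ℝ) ≤ (I.card : ℝ) ^ 2 := by
      rw [sq]
      exact_mod_cast h1
    refine h2.trans ((pow_le_pow_left₀ (Nat.cast_nonneg _) (hK R I hI) 2).trans_eq ?_)
    rw [mul_pow, mul_comm 2 R, Real.rpow_mul zero_le_two]
    norm_num

/-- A single coordinate axis suffices: there `‖j‖₁ = ‖j‖_∞`, so all levels up to `⌊R⌋₊` belong to
the cross. This is what bounds `R` by `log M`. -/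
theorem two_rpow_le_card {d : ℕ} (hd : 1 ≤ d) {T R : ℝ} (hT1 : T < 1) (hR : 1 ≤ R)
    {I : Finset (Fin d → ℤ)} (hI : (I : Set (Fin d → ℤ)) = hyperbolicCross d T R) :
    (2 : ℝ) ^ R ≤ I.card := by
  classical
  obtain ⟨n, rfl⟩ : ∃ n, d = n + 1 := ⟨d - 1, by omega⟩
  have hR0 : 0 ≤ R := by linarith
  have h1 : ((Finset.Icc (-2 ^ ⌊R⌋₊ : ℤ) (2 ^ ⌊R⌋₊)).image
      fun a => (Pi.single 0 a : Fin (n + 1) → ℤ)) ⊆ I := by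
    intro k hk
    obtain ⟨a, ha, rfl⟩ := Finset.mem_image.1 hk
    have ha' : dyadicLevel a ≤ ⌊R⌋₊ := dyadicLevel_le (by
      zify
      exact abs_le.2 (Finset.mem_Icc.1 ha))
    have h0 : dyadicLevel 0 = 0 := Nat.le_zero.1 (dyadicLevel_le (by simp))
    have h2 : (fun s => dyadicLevel ((Pi.single 0 a : Fin (n + 1) → ℤ) s)) =
        Pi.single 0 (dyadicLevel a) := by
      ext s
      by_cases hs : s = 0
      · subst hs; simp
      · simp [hs, h0]
    rw [← Finset.mem_coe, hI, mem_hyperbolicCross_iff, levelSet, Set.mem_ofPred_eq, h2]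
    have h3 : Finset.univ.sup (Pi.single 0 (dyadicLevel a) : Fin (n + 1) → ℕ) = dyadicLevel a := by
      refine le_antisymm (Finset.sup_le fun i _ => ?_) ?_
      · by_cases hi : i = 0
        · subst hi; simp
        · simp [hi]
      · simpa using Finset.le_sup (f := (Pi.single 0 (dyadicLevel a) : Fin (n + 1) → ℕ))
          (Finset.mem_univ 0)
    rw [h3, Finset.sum_pi_single']
    simp only [Finset.mem_univ, if_true]
    have h4 : (dyadicLevel a : ℝ) ≤ R := (Nat.cast_le.2 ha').trans (Nat.floor_le hR0)
    have hn : (0 : ℝ) ≤ n := Nat.cast_nonneg n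
    push_cast
    nlinarith [mul_le_mul_of_nonneg_left h4 (by linarith : 0 ≤ 1 - T)]
  have h2 := Finset.card_le_card h1
  rw [Finset.card_image_of_injective _ (Pi.single_injective (M := fun _ : Fin (n + 1) => ℤ) 0),
    Int.card_Icc] at h2
  have h3 : 2 ^ (⌊R⌋₊ + 1) ≤ I.card := by
    refine le_trans ?_ h2
    have : (2 : ℤ) ^ ⌊R⌋₊ + 1 - -2 ^ ⌊R⌋₊ = ((2 ^ (⌊R⌋₊ + 1) + 1 : ℕ) : ℤ) := by
      push_cast
      ring
    rw [this, Int.toNat_natCast]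
    omega
  calc (2 : ℝ) ^ R ≤ 2 ^ ((⌊R⌋₊ + 1 : ℕ) : ℝ) :=
        Real.rpow_le_rpow_of_exponent_le (by norm_num) (by
          push_cast
          exact (Nat.lt_floor_add_one R).le)
    _ = ((2 ^ (⌊R⌋₊ + 1) : ℕ) : ℝ) := by
        rw [Real.rpow_natCast]
        push_cast
        rfl
    _ ≤ I.card := Nat.cast_le.2 h3

/-! ### Aliasing, reconstruction and the Fourier series -/

theorem mFourier_latticePoint {d : ℕ} (k z : Fin d → ℤ) (M j : ℕ) :
    mFourier k (latticePoint z M j) =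
      Complex.exp (2 * Real.pi * Complex.I * (∑ s, k s * z s : ℤ) / M) ^ j := by
  rw [← Complex.exp_nat_mul]
  simp only [mFourier, ContinuousMap.coe_mk, latticePoint, fourier_coe_apply]
  rw [← Complex.exp_sum]
  congr 1
  push_cast
  rw [Finset.mul_sum, Finset.sum_div, Finset.mul_sum]
  refine Finset.sum_congr rfl fun s _ => ?_
  field_simp

/-- Aliasing on a rank-1 lattice. -/
theorem latticeCoeff_mFourier {d : ℕ} {M : ℕ} (hM : 0 < M) (z l k : Fin d → ℤ) :
    latticeCoeff z M (mFourier l) k = if (M : ℤ) ∣ ∑ s, (l s - k s) * z s then 1 else 0 := by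
  have hM' : (M : ℂ) ≠ 0 := by exact_mod_cast hM.ne'
  have h1 : ∀ j, mFourier l (latticePoint z M j) * mFourier (-k) (latticePoint z M j) =
      Complex.exp (2 * Real.pi * Complex.I * (∑ s, (l s - k s) * z s : ℤ) / M) ^ j := fun j => by
    rw [← mFourier_add, mFourier_latticePoint]
    simp only [Pi.add_apply, Pi.neg_apply, sub_eq_add_neg]
  simp only [latticeCoeff, h1]
  set a : ℤ := ∑ s, (l s - k s) * z s
  have h2 : Complex.exp (2 * Real.pi * Complex.I * a / M) = 1 ↔ (M : ℤ) ∣ a := by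
    rw [Complex.exp_eq_one_iff]
    constructor
    · rintro ⟨n, hn⟩
      refine ⟨n, ?_⟩
      have h3 : (2 * Real.pi * Complex.I : ℂ) * (a : ℂ) = (2 * Real.pi * Complex.I) * (M * n) := by
        rw [div_eq_iff hM'] at hn
        rw [hn]
        ring
      have h4 := mul_left_cancel₀ Complex.two_pi_I_ne_zero h3
      exact_mod_cast h4
    · rintro ⟨n, hn⟩
      refine ⟨n, ?_⟩
      rw [hn]
      push_cast
      field_simp
  split_ifs with h
  · rw [h2.2 h]
    simp [hM']
  -- A geometric sum over the powers of an `M`-th root of unity different from 1 vanishes.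
  · rw [geom_sum_eq (fun h3 => h (h2.1 h3)), ← Complex.exp_nat_mul,
      show (M : ℂ) * (2 * Real.pi * Complex.I * a / M) = a * (2 * Real.pi * Complex.I) by
        field_simp, Complex.exp_int_mul_two_pi_mul_I]
    simp

theorem summable_smul_mFourier {d : ℕ} {a : (Fin d → ℤ) → ℂ} (ha : Summable a) :
    Summable fun k => a k • (mFourier k : C(UnitAddTorus (Fin d), ℂ)) := by
  refine .of_norm ?_
  simpa only [norm_smul, mFourier_norm, mul_one] using ha.norm

/-- A square-integrable function with summable Fourier coefficients has a continuous
representative. -/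
theorem exists_continuous_ae_eq {d : ℕ} (f : Lp ℂ 2 (torusMeasure d))
    (hf : Summable (mFourierCoeff ⇑f)) :
    ∃ g : C(UnitAddTorus (Fin d), ℂ), ⇑g =ᵐ[torusMeasure d] ⇑f ∧
      HasSum (fun k => mFourierCoeff ⇑f k • (mFourier k : C(UnitAddTorus (Fin d), ℂ))) g := by
  obtain ⟨g, hg⟩ := summable_smul_mFourier hf
  have h1 : HasSum (fun k => mFourierCoeff ⇑f k • (mFourierLp 2 k : Lp ℂ 2 (torusMeasure d)))
      (ContinuousMap.toLp 2 (torusMeasure d) ℂ g) := by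
    have h2 := (ContinuousMap.toLp (E := ℂ) 2 (torusMeasure d) ℂ).hasSum hg
    simp only [map_smul] at h2
    exact h2
  -- The uniform limit `g` of the Fourier series is also its L₂ limit, which is `f`.
  have h2 : ContinuousMap.toLp 2 (torusMeasure d) ℂ g = f :=
    h1.unique (hasSum_mFourier_series_L2 f)
  have h3 : ⇑g =ᵐ[torusMeasure d] ⇑f := by
    have h4 := ContinuousMap.coeFn_toLp (p := 2) (𝕜 := ℂ) (torusMeasure d) g
    rw [h2] at h4
    exact h4.symm
  exact ⟨g, h3, hg⟩

/-- The lattice rule as a continuous linear functional. -/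
noncomputable def latticeCoeffCLM {d : ℕ} (z : Fin d → ℤ) (M : ℕ) (k : Fin d → ℤ) :
    C(UnitAddTorus (Fin d), ℂ) →L[ℂ] ℂ :=
  (1 / (M : ℂ)) • ∑ j ∈ Finset.range M,
    mFourier (-k) (latticePoint z M j) • ContinuousMap.evalCLM ℂ (latticePoint z M j)

theorem latticeCoeffCLM_apply {d : ℕ} (z : Fin d → ℤ) (M : ℕ) (k : Fin d → ℤ)
    (f : C(UnitAddTorus (Fin d), ℂ)) : latticeCoeffCLM z M k f = latticeCoeff z M f k := by
  simp only [latticeCoeffCLM, latticeCoeff, smul_apply,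
    sum_apply, smul_eq_mul, ContinuousMap.evalCLM_apply, mul_comm]

/-- The Fourier coefficient as a continuous linear functional. -/
noncomputable def mFourierCoeffCLM {d : ℕ} (k : Fin d → ℤ) :
    C(UnitAddTorus (Fin d), ℂ) →L[ℂ] ℂ :=
  (innerSL ℂ (mFourierLp 2 k : Lp ℂ 2 (torusMeasure d))).comp
    (ContinuousMap.toLp (E := ℂ) 2 (torusMeasure d) ℂ)

theorem mFourierCoeffCLM_apply {d : ℕ} (k : Fin d → ℤ) (f : C(UnitAddTorus (Fin d), ℂ)) :
    mFourierCoeffCLM k f = mFourierCoeff ⇑f k := by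
  rw [← mFourierCoeff_toLp, ← mFourierBasis_repr, HilbertBasis.repr_apply_apply, coe_mFourierBasis]
  rfl

theorem mFourierCoeff_mFourier {d : ℕ} (l k : Fin d → ℤ) :
    mFourierCoeff ⇑(mFourier l : C(UnitAddTorus (Fin d), ℂ)) k = if k = l then 1 else 0 := by
  rw [← mFourierCoeffCLM_apply]
  exact orthonormal_iff_ite.1 orthonormal_mFourier k l

theorem mFourierCoeff_samplingOperator {d : ℕ} (I : Finset (Fin d → ℤ)) (z : Fin d → ℤ) (M : ℕ)
    (f : C(UnitAddTorus (Fin d), ℂ)) (k : Fin d → ℤ) :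
    mFourierCoeff ⇑(samplingOperator I z M f) k = if k ∈ I then latticeCoeff z M f k else 0 := by
  rw [← mFourierCoeffCLM_apply, samplingOperator, map_sum]
  simp only [map_smul, mFourierCoeffCLM_apply, mFourierCoeff_mFourier, smul_eq_mul, mul_ite,
    mul_one, mul_zero]
  rw [Finset.sum_ite_eq]

/-- If `l` aliases to `k`, the sampled character of `l` has coefficient 1 at `k`. Reconstruction
returns that character itself, whose coefficient at `k` is 1 only for `k = l`. So the residues `k·z`
mod `M` are distinct on `I`. -/
theorem IsReconstructing.eq_of_dvd {d : ℕ} {I : Finset (Fin d → ℤ)} {z : Fin d → ℤ} {M : ℕ}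
    (hM : 0 < M) (h : IsReconstructing I z M) {k l : Fin d → ℤ} (hk : k ∈ I) (hl : l ∈ I)
    (hd : (M : ℤ) ∣ ∑ s, (l s - k s) * z s) : k = l := by
  have h1 := h (mFourier l) (Submodule.subset_span ⟨l, hl, rfl⟩)
  have h2 := mFourierCoeff_samplingOperator I z M (mFourier l) k
  rw [h1, mFourierCoeff_mFourier, if_pos hk, latticeCoeff_mFourier hM, if_pos hd] at h2
  by_contra hne
  rw [if_neg hne] at h2
  exact zero_ne_one h2

theorem IsReconstructing.card_le {d : ℕ} {I : Finset (Fin d → ℤ)} {z : Fin d → ℤ} {M : ℕ}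
    (hM : 0 < M) (h : IsReconstructing I z M) : I.card ≤ M := by
  have : NeZero M := ⟨hM.ne'⟩
  rw [← ZMod.card M, ← Finset.card_univ]
  refine Finset.card_le_card_of_injOn (fun k => ((∑ s, k s * z s : ℤ) : ZMod M))
    (fun _ _ => Finset.mem_coe.2 (Finset.mem_univ _)) fun k hk l hl hkl => ?_
  refine h.eq_of_dvd hM hk hl ?_
  have h1 := (ZMod.intCast_eq_intCast_iff_dvd_sub _ _ _).1 hkl
  rw [← Finset.sum_sub_distrib] at h1
  simpa only [sub_mul] using h1

/-- Two aliases of `l` in `I` would alias to each other, so at most one term is nonzero, and it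
equals 1. -/
theorem IsReconstructing.sum_enorm_latticeCoeff_le {d : ℕ} {I : Finset (Fin d → ℤ)}
    {z : Fin d → ℤ} {M : ℕ} (hM : 0 < M) (h : IsReconstructing I z M) (l : Fin d → ℤ) :
    ∑ k ∈ I, ‖latticeCoeff z M (mFourier l) k‖ₑ ≤ 1 := by
  classical
  by_cases hl : ∃ k ∈ I, (M : ℤ) ∣ ∑ s, (l s - k s) * z s
  · obtain ⟨k, hk, hkl⟩ := hl
    rw [Finset.sum_eq_single k]
    · rw [latticeCoeff_mFourier hM, if_pos hkl]
      simp
    · intro k' hk' hne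
      rw [latticeCoeff_mFourier hM, if_neg, enorm_zero]
      intro hkl'
      refine hne (h.eq_of_dvd hM hk' hk ?_)
      have h1 := dvd_sub hkl' hkl
      rw [← Finset.sum_sub_distrib] at h1
      rwa [Finset.sum_congr rfl fun s _ => (by ring : (l s - k' s) * z s - (l s - k s) * z s =
        (k s - k' s) * z s)] at h1
    · exact fun hk' => absurd hk hk'
  · push Not at hl
    rw [Finset.sum_eq_zero]
    · exact zero_le
    · intro k hk
      rw [latticeCoeff_mFourier hM, if_neg (hl k hk), enorm_zero]

/-- The aliasing error is controlled by the truncation error. -/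
theorem IsReconstructing.wienerNorm_sub_le {d : ℕ} {I : Finset (Fin d → ℤ)}
    {z : Fin d → ℤ} {M : ℕ} (hM : 0 < M) (h : IsReconstructing I z M)
    {g : C(UnitAddTorus (Fin d), ℂ)} {a : (Fin d → ℤ) → ℂ}
    (hg : HasSum (fun k => a k • (mFourier k : C(UnitAddTorus (Fin d), ℂ))) g) :
    wienerNorm (g - samplingOperator I z M g) ≤ 2 * ∑' l, if l ∈ I then 0 else ‖a l‖ₑ := by
  classical
  have hcoeff : ∀ k, mFourierCoeff ⇑g k = a k := fun k => by
    have h1 := (mFourierCoeffCLM k).hasSum hg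
    simp only [map_smul, mFourierCoeffCLM_apply, mFourierCoeff_mFourier, smul_eq_mul, mul_ite,
      mul_one, mul_zero] at h1
    exact h1.unique (hasSum_ite_eq k (a k) |>.congr_fun fun l => by
      by_cases hl : k = l
      · subst hl
        simp
      · rw [if_neg hl, if_neg (Ne.symm hl)])
  have hlat : ∀ k ∈ I, ‖a k - latticeCoeff z M g k‖ₑ ≤
      ∑' l, (if l ∈ I then 0 else ‖a l‖ₑ) * ‖latticeCoeff z M (mFourier l) k‖ₑ := by
    intro k hk
    have h1 := (latticeCoeffCLM z M k).hasSum hg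
    simp only [map_smul, latticeCoeffCLM_apply, smul_eq_mul] at h1
    -- Writing `a k` as a point mass at `k` lets the two series be compared term by term:
    -- frequencies in `I` cancel exactly and only outside frequencies alias into `k`.
    have h2 := (hasSum_ite_eq k (a k)).sub h1
    rw [← h2.tsum_eq]
    refine (enorm_tsum_le_tsum_enorm).trans (ENNReal.tsum_le_tsum fun l => ?_)
    by_cases hl : l ∈ I
    · rw [if_pos hl, zero_mul, latticeCoeff_mFourier hM]
      by_cases hlk : l = k
      · subst hlk
        simp
      · rw [if_neg hlk, if_neg]
        · simp
        · exact fun hdvd => hlk (h.eq_of_dvd hM hk hl hdvd).symm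
    · have hlk : l ≠ k := fun hlk => hl (hlk ▸ hk)
      rw [if_neg hlk, if_neg hl, zero_sub, enorm_neg, enorm_mul]
  have hsplit : ∀ k, ‖mFourierCoeff ⇑(g - samplingOperator I z M g) k‖ₑ =
      (if k ∈ I then ‖a k - latticeCoeff z M g k‖ₑ else 0) + if k ∈ I then 0 else ‖a k‖ₑ := by
    intro k
    rw [← mFourierCoeffCLM_apply, map_sub, mFourierCoeffCLM_apply, mFourierCoeffCLM_apply, hcoeff,
      mFourierCoeff_samplingOperator]
    split_ifs <;> simp
  -- Outside `I` the error is pure truncation, which is one copy of the tail. Inside `I` it is pure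
  -- aliasing; exchanging the sums bounds it by a second copy.
  rw [wienerNorm, tsum_congr hsplit, ENNReal.tsum_add, two_mul]
  refine add_le_add_left ?_ _
  rw [tsum_eq_sum (s := I) fun k hk => if_neg hk]
  calc ∑ k ∈ I, (if k ∈ I then ‖a k - latticeCoeff z M g k‖ₑ else 0)
      ≤ ∑ k ∈ I, ∑' l, (if l ∈ I then 0 else ‖a l‖ₑ) * ‖latticeCoeff z M (mFourier l) k‖ₑ :=
        Finset.sum_le_sum fun k hk => by
          rw [if_pos hk]
          exact hlat k hk
    _ = ∑' l, (if l ∈ I then 0 else ‖a l‖ₑ) * ∑ k ∈ I, ‖latticeCoeff z M (mFourier l) k‖ₑ := by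
        rw [← Summable.tsum_finsetSum fun _ _ => ENNReal.summable]
        exact tsum_congr fun l => (Finset.mul_sum _ _ _).symm
    _ ≤ ∑' l, if l ∈ I then 0 else ‖a l‖ₑ := ENNReal.tsum_le_tsum fun l =>
        mul_le_of_le_one_right' (h.sum_enorm_latticeCoeff_le hM l)

/-! ### The error bound and the rate in terms of the lattice size -/

theorem tsum_mul_le_sqrt_mul_sqrt {A : Type*} (f g : A → ℝ≥0∞) :
    ∑' a, f a * g a ≤ (∑' a, f a ^ 2) ^ (1 / 2 : ℝ) * (∑' a, g a ^ 2) ^ (1 / 2 : ℝ) := by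
  rw [ENNReal.tsum_eq_iSup_sum]
  refine iSup_le fun s => (ENNReal.inner_le_Lp_mul_Lq s f g Real.HolderConjugate.two_two).trans ?_
  simp only [ENNReal.rpow_ofNat]
  gcongr
  · exact ENNReal.sum_le_tsum s
  · exact ENNReal.sum_le_tsum s

/-- Weighted Cauchy-Schwarz inequality for the Fourier coefficients outside of `I`. -/
theorem tsum_enorm_mFourierCoeff_le {d : ℕ} (α β : ℝ) (I : Finset (Fin d → ℤ))
    (f : Lp ℂ 2 (torusMeasure d)) :
    ∑' k, (if k ∈ I then 0 else ‖mFourierCoeff (⇑f) k‖ₑ) ≤ hybridNorm α β f *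
      (∑' k, if k ∈ I then 0 else (ENNReal.ofReal (weight α β k))⁻¹) ^ (1 / 2 : ℝ) := by
  have h0 : ∀ k : Fin d → ℤ, ENNReal.ofReal (weight α β k) ≠ 0 := fun k => by
    simpa using weight_pos α β k
  have h1 := tsum_mul_le_sqrt_mul_sqrt
    (fun k => ‖mFourierCoeff (⇑f) k‖ₑ * ENNReal.ofReal (weight α β k) ^ (1 / 2 : ℝ))
    (fun k => if k ∈ I then 0 else (ENNReal.ofReal (weight α β k))⁻¹ ^ (1 / 2 : ℝ))
  have hsq : ∀ x : ℝ≥0∞, (x ^ (1 / 2 : ℝ)) ^ 2 = x := fun x => by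
    rw [← ENNReal.rpow_natCast, ← ENNReal.rpow_mul]
    norm_num
  refine le_trans (ENNReal.tsum_le_tsum fun k => ?_) (h1.trans_eq ?_)
  · split_ifs
    · exact zero_le
    · rw [mul_assoc, ← ENNReal.mul_rpow_of_nonneg _ _ (by norm_num),
        ENNReal.mul_inv_cancel (h0 k) ENNReal.ofReal_ne_top]
      simp
  · congr 2
    · refine tsum_congr fun k => ?_
      rw [mul_pow, hsq, ENNReal.ofReal_mul (by positivity), ENNReal.ofReal_pow (norm_nonneg _),
        ofReal_norm]
    · refine tsum_congr fun k => ?_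
      split_ifs
      · simp
      · exact hsq _

/-- Finiteness in `hI` makes the Fourier coefficients of `f` summable, the finitely many in `I`
being harmless. This yields the continuous representative without which the infimum would be `∞`. -/
theorem samplingErrorNorm_le {d : ℕ} (α β : ℝ) {I : Finset (Fin d → ℤ)} {z : Fin d → ℤ} {M : ℕ}
    (hM : 0 < M) (h : IsReconstructing I z M)
    (hI : ∑' k : Fin d → ℤ, (if k ∈ I then 0 else (ENNReal.ofReal (weight α β k))⁻¹) ≠ ⊤) :
    samplingErrorNorm α β I z M ≤
      2 * (∑' k, if k ∈ I then 0 else (ENNReal.ofReal (weight α β k))⁻¹) ^ (1 / 2 : ℝ) := by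
  classical
  refine iSup₂_le fun f hf => ?_
  have h1 : ∑' k, (if k ∈ I then 0 else ‖mFourierCoeff (⇑f) k‖ₑ) ≤
      (∑' k, if k ∈ I then 0 else (ENNReal.ofReal (weight α β k))⁻¹) ^ (1 / 2 : ℝ) :=
    (tsum_enorm_mFourierCoeff_le α β I f).trans (mul_le_of_le_one_left' hf)
  have h2 : ∑' k, ‖mFourierCoeff (⇑f) k‖ₑ ≠ ⊤ := by
    have h3 : ∀ k, ‖mFourierCoeff (⇑f) k‖ₑ = (if k ∈ I then ‖mFourierCoeff (⇑f) k‖ₑ else 0) +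
        if k ∈ I then 0 else ‖mFourierCoeff (⇑f) k‖ₑ := fun k => by split_ifs <;> simp
    rw [tsum_congr h3, ENNReal.tsum_add, tsum_eq_sum (s := I) fun k hk => if_neg hk]
    refine ENNReal.add_ne_top.2 ⟨ENNReal.sum_ne_top.2 fun k _ => ?_,
      ne_top_of_le_ne_top (ENNReal.rpow_ne_top_of_nonneg (by norm_num) hI) h1⟩
    split_ifs <;> simp
  have h3 : Summable (mFourierCoeff ⇑f) := by
    refine .of_norm ?_
    have := ENNReal.summable_toReal h2
    simpa using this
  obtain ⟨g, hg1, hg3⟩ := exists_continuous_ae_eq f h3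
  refine (iInf₂_le g hg1).trans ((h.wienerNorm_sub_le hM hg3).trans ?_)
  gcongr

theorem exists_samplingErrorNorm_le {d : ℕ} (hd : 2 ≤ d) {α β : ℝ} (hα : 1 / 2 < α) (hβ : β ≤ 0)
    (hαβ : 1 / 2 < α + β) :
    ∃ C : ℝ, 0 < C ∧ ∀ R : ℝ, 1 ≤ R → ∀ I : Finset (Fin d → ℤ),
      (I : Set (Fin d → ℤ)) = hyperbolicCross d (-β / α) R →
      ∀ (z : Fin d → ℤ) (M : ℕ), 0 < M → IsReconstructing I z M →
        samplingErrorNorm α β I z M ≤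
          ENNReal.ofReal (C * ((2 : ℝ) ^ (-(α + β - 1 / 2) * R) *
            (if β = 0 then R ^ (((d : ℝ) - 1) / 2) else 1))) := by
  obtain ⟨K, hK, h⟩ := exists_tsum_inv_weight_le hd hα hβ hαβ
  have hK2 : K ^ (1 / 2 : ℝ) ≠ ⊤ := ENNReal.rpow_ne_top_of_nonneg (by norm_num) hK
  -- The factor 2 is truncation plus aliasing, the root comes from Cauchy-Schwarz, and `+ 1` ensures
  -- positivity.
  refine ⟨2 * (K ^ (1 / 2 : ℝ)).toReal + 1, by positivity, fun R hR I hI z M hM hrec => ?_⟩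
  have h1 := h R hR I hI
  have hpos : 0 < R := by linarith
  refine (samplingErrorNorm_le α β hM hrec (ne_top_of_le_ne_top ?_ h1)).trans ?_
  · refine ENNReal.mul_ne_top hK (ENNReal.mul_ne_top (two_rpow_ne_top _) ?_)
    split_ifs
    · exact ENNReal.pow_ne_top ENNReal.ofReal_ne_top
    · exact ENNReal.one_ne_top
  have h2 : (K * (2 ^ (-(2 * (α + β) - 1) * R) *
      (if β = 0 then ENNReal.ofReal R ^ (d - 1) else 1))) ^ (1 / 2 : ℝ) =
      K ^ (1 / 2 : ℝ) * ENNReal.ofReal ((2 : ℝ) ^ (-(α + β - 1 / 2) * R) *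
            (if β = 0 then R ^ (((d : ℝ) - 1) / 2) else 1)) := by
    rw [ENNReal.mul_rpow_of_nonneg _ _ (by norm_num), ENNReal.mul_rpow_of_nonneg _ _ (by norm_num),
      ← ENNReal.rpow_mul, ENNReal.ofReal_mul (by positivity), ofReal_two_rpow]
    congr 3
    · ring
    · split_ifs
      · rw [← ENNReal.rpow_natCast, ← ENNReal.rpow_mul, ENNReal.ofReal_rpow_of_pos hpos,
          Nat.cast_sub (by omega)]
        congr 2
        push_cast
        ring
      · simp
  calc _ ≤ 2 * (K * (2 ^ (-(2 * (α + β) - 1) * R) *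
      (if β = 0 then ENNReal.ofReal R ^ (d - 1) else 1))) ^ (1 / 2 : ℝ) := by gcongr
    _ = ENNReal.ofReal (2 * (K ^ (1 / 2 : ℝ)).toReal) *
        ENNReal.ofReal ((2 : ℝ) ^ (-(α + β - 1 / 2) * R) *
            (if β = 0 then R ^ (((d : ℝ) - 1) / 2) else 1)) := by
        rw [h2, ENNReal.ofReal_mul zero_le_two, ENNReal.ofReal_toReal hK2, ENNReal.ofReal_ofNat,
          mul_assoc]
    _ ≤ _ := by
        rw [← ENNReal.ofReal_mul (by positivity)]
        refine ENNReal.ofReal_le_ofReal (mul_le_mul_of_nonneg_right (by linarith) ?_)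
        split_ifs <;> positivity

theorem exists_rate_le {d : ℕ} (hd : 2 ≤ d) {α β : ℝ} (hα : 1 / 2 < α) (hβ : β ≤ 0)
    (hαβ : 1 / 2 < α + β) (κ : ℝ) :
    ∃ C : ℝ, 0 < C ∧ ∀ R : ℝ, 1 ≤ R → ∀ I : Finset (Fin d → ℤ),
      (I : Set (Fin d → ℤ)) = hyperbolicCross d (-β / α) R →
      ∀ (z : Fin d → ℤ) (M : ℕ), IsCBCReconstructing κ I z M →
        (2 : ℝ) ^ (-(α + β - 1 / 2) * R) *
            (if β = 0 then R ^ (((d : ℝ) - 1) / 2) else 1) ≤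
          C * ((M : ℝ) ^ (-(α + β - 1 / 2) / 2) *
            (if β = 0 then
              Real.log M ^ (((d : ℝ) - 2) / 2 * (α - 1 / 2) + ((d : ℝ) - 1) / 2)
            else 1)) := by
  have hα0 : 0 < α := by linarith
  have hd' : (2 : ℝ) ≤ d := by exact_mod_cast hd
  have hT0 : 0 ≤ -β / α := div_nonneg (by linarith) hα0.le
  have hT1 : -β / α < 1 := by
    rw [div_lt_one hα0]
    linarith
  obtain ⟨K, hK0, hK⟩ := exists_max_card_differenceSet_boxWidth_le hd hT0 hT1
  set γ : ℝ := α + β - 1 / 2 with hγ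
  have hγ0 : 0 < γ := by linarith
  -- The absolute value and the `+ 1` make `L` positive for every real `κ`.
  set L : ℝ := |κ| * K + 1 with hL
  have hL0 : 0 < L := by positivity
  set e : ℝ := ((d : ℝ) - 2) / 2 * (α - 1 / 2) + ((d : ℝ) - 1) / 2 with he
  have he0 : 0 ≤ e := add_nonneg (mul_nonneg (by linarith) (by linarith)) (by linarith)
  have hlog2 : 0 < Real.log 2 := Real.log_pos one_lt_two
  refine ⟨L ^ (γ / 2) * (if β = 0 then (Real.log 2)⁻¹ ^ e else 1),
    by split_ifs <;> positivity, fun R hR I hI z M hcbc => ?_⟩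
  obtain ⟨p, hp, -, -, hM, hMp, hrec⟩ := hcbc
  have hR0 : 0 < R := by linarith
  have hM0 : (0 : ℝ) < M := by exact_mod_cast hM
  have hcond : -β / α = 0 ↔ β = 0 := by
    rw [div_eq_zero_iff, neg_eq_zero, or_iff_left hα0.ne']
  set P : ℝ := if β = 0 then R ^ (d - 2) else 1 with hP
  have hP0 : 0 < P := by rw [hP]; split_ifs <;> positivity
  have hMle : (M : ℝ) ≤ L * (2 ^ (2 * R) * P) := by
    have h1 := hK R hR I hI
    simp only [hcond] at h1
    calc (M : ℝ) ≤ p := Nat.cast_le.2 hMp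
      _ ≤ κ * (max (differenceSet I).card (boxWidth I + 1) : ℕ) := hp
      _ ≤ |κ| * (max (differenceSet I).card (boxWidth I + 1) : ℕ) :=
          mul_le_mul_of_nonneg_right (le_abs_self κ) (Nat.cast_nonneg _)
      _ ≤ |κ| * (K * (2 ^ (2 * R) * P)) := mul_le_mul_of_nonneg_left h1 (abs_nonneg κ)
      _ ≤ L * (2 ^ (2 * R) * P) := by
          rw [hL, add_mul, mul_assoc]
          exact le_add_of_nonneg_right (by positivity)
  -- `hMle` raised to the power `γ / 2`, then solved for `2^(-γ R)`.
  have hrate : (2 : ℝ) ^ (-γ * R) ≤ L ^ (γ / 2) * P ^ (γ / 2) * (M : ℝ) ^ (-γ / 2) := by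
    have h1 : (M : ℝ) ^ (γ / 2) ≤ L ^ (γ / 2) * (2 ^ (γ * R) * P ^ (γ / 2)) := by
      refine (Real.rpow_le_rpow hM0.le hMle (by positivity)).trans_eq ?_
      rw [Real.mul_rpow hL0.le (by positivity), Real.mul_rpow (by positivity) hP0.le,
        ← Real.rpow_mul zero_le_two]
      congr 3
      ring
    rw [neg_mul, Real.rpow_neg zero_le_two, neg_div, Real.rpow_neg hM0.le, ← div_eq_mul_inv,
      le_div_iff₀ (by positivity), inv_mul_le_iff₀ (by positivity)]
    linarith
  by_cases hβ0 : β = 0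
  · simp only [hβ0, if_true] at hP ⊢
    have hRlog : R ≤ (Real.log 2)⁻¹ * Real.log M := by
      have h1 := (two_rpow_le_card (by omega) hT1 hR hI).trans (Nat.cast_le.2 (hrec.card_le hM))
      have h2 := Real.log_le_log (by positivity) h1
      rw [Real.log_rpow two_pos] at h2
      rw [inv_mul_eq_div, le_div_iff₀ hlog2]
      exact h2
    have hlogM : 0 ≤ Real.log M := Real.log_natCast_nonneg M
    have hRe : P ^ (γ / 2) * R ^ (((d : ℝ) - 1) / 2) ≤ (Real.log 2)⁻¹ ^ e * Real.log M ^ e := by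
      -- With `β = 0` one has `γ = α - 1/2`. The `R^(d-2)` in the lattice size gives the first
      -- summand of `e`, the truncation error the second.
      have h1 : P ^ (γ / 2) * R ^ (((d : ℝ) - 1) / 2) = R ^ e := by
        rw [hP, ← Real.rpow_natCast, ← Real.rpow_mul hR0.le, ← Real.rpow_add hR0,
          Nat.cast_sub hd, he, hγ, hβ0]
        congr 1
        push_cast
        ring
      rw [h1, ← Real.mul_rpow (by positivity) hlogM]
      exact Real.rpow_le_rpow hR0.le hRlog he0
    calc (2 : ℝ) ^ (-γ * R) * R ^ (((d : ℝ) - 1) / 2)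
        ≤ L ^ (γ / 2) * P ^ (γ / 2) * (M : ℝ) ^ (-γ / 2) * R ^ (((d : ℝ) - 1) / 2) :=
          mul_le_mul_of_nonneg_right hrate (by positivity)
      _ = L ^ (γ / 2) * (M : ℝ) ^ (-γ / 2) * (P ^ (γ / 2) * R ^ (((d : ℝ) - 1) / 2)) := by ring
      _ ≤ L ^ (γ / 2) * (M : ℝ) ^ (-γ / 2) * ((Real.log 2)⁻¹ ^ e * Real.log M ^ e) :=
          mul_le_mul_of_nonneg_left hRe (by positivity)
      _ = _ := by ring
  · simp only [hβ0, if_false] at hP ⊢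
    rw [hP, Real.one_rpow] at hrate
    simpa using hrate

end LatticeSampling

theorem mainTheorem7 (d : ℕ) (hd : 2 ≤ d) (α β : ℝ) (hα : 1 / 2 < α) (hβ : β ≤ 0)
    (hαβ : 1 / 2 < α + β) :
    ∃ C₁ : ℝ, 0 < C₁ ∧ ∀ κ : ℝ, ∃ C₂ : ℝ, 0 < C₂ ∧
      ∀ R : ℝ, 1 ≤ R →
      ∀ I : Finset (Fin d → ℤ), (I : Set (Fin d → ℤ)) =
          LatticeSampling.hyperbolicCross d (-β / α) R →
      ∀ (z : Fin d → ℤ) (M : ℕ), LatticeSampling.IsCBCReconstructing κ I z M →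
        LatticeSampling.samplingErrorNorm α β I z M ≤
          ENNReal.ofReal (C₁ * ((2 : ℝ) ^ (-(α + β - 1 / 2) * R) *
            (if β = 0 then R ^ (((d : ℝ) - 1) / 2) else 1))) ∧
        (2 : ℝ) ^ (-(α + β - 1 / 2) * R) *
            (if β = 0 then R ^ (((d : ℝ) - 1) / 2) else 1) ≤
          C₂ * ((M : ℝ) ^ (-(α + β - 1 / 2) / 2) *
            (if β = 0 then
              Real.log M ^ (((d : ℝ) - 2) / 2 * (α - 1 / 2) + ((d : ℝ) - 1) / 2)
            else 1)) := by
  obtain ⟨C₁, hC₁, h₁⟩ := LatticeSampling.exists_samplingErrorNorm_le hd hα hβ hαβ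
  refine ⟨C₁, hC₁, fun κ => ?_⟩
  obtain ⟨C₂, hC₂, h₂⟩ := LatticeSampling.exists_rate_le hd hα hβ hαβ κ
  refine ⟨C₂, hC₂, fun R hR I hI z M hcbc => ⟨?_, h₂ R hR I hI z M hcbc⟩⟩
  obtain ⟨p, -, -, -, hM, -, hrec⟩ := hcbc
  exact h₁ R hR I hI z M hM hrec
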